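/- **Theorem 3.** Let $k_1\ge l_1\ge 0$ and $k_2\ge l_2\ge 0$ be integers with $k_1+l_1+k_2+l_2>0$, and put $\alpha=\frac{k_1-l_1}2$, $\beta=\frac{k_2-l_2}2$, $n=l_1+l_2$. *Polynomials of least deviation.* Let $\mathbb B=\{(z_1,z_2)\in\mathbb C^2:|z_1|^2+|z_2|^2\le 1\}$ and $\|f\|=\sup_{\mathbb B}|f|$. Polynomials are polynomials in $z_1,\bar z_1,z_2,\bar z_2$ with complex coefficients. A polynomial of least deviation from zero on $\mathbb B$ is an $f=z_1^{k_1}\bar z_1^{l_1}z_2^{k_2}\bar z_2^{l_2}-P$, with $P$ a polynomial of total degree less than $k_1+l_1+k_2+l_2$, for which $\|f\|$ is the smallest possible, that is, equal to the infimum over all such $P$. The function $f/\|f\|$ is then called a normalized polynomial of least deviation from zero on $\mathbb B$. *The conformal mapping.* Let $$\Omega_n(\alpha,\beta)=\Big\{w=u+iv:-\beta<\frac v\pi<\alpha+n\Big\}\setminus\bigcup_{j=0}^n\Big\{w=u+iv:\frac v\pi=j,\ u\le 0\Big\},$$ and let $\infty_0$, $\infty_j$ ($1\le j\le n$), $\infty_{n+1}$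 be its infinite boundary points $-\infty+iv$ in the half-strips $n<\frac v\pi<n+\alpha$, $n-j<\frac v\pi<n-j+1$, $-\beta<\frac v\pi<0$ respectively, and $\infty_{n+2}=+\infty+iv$. If $\alpha=0$, let $\infty_0$ denote the finite boundary point $n\pi i$; if $\beta=0$, let $\infty_{n+1}$ denote the finite boundary point $0$. There is a conformal mapping $w$ of the open upper half-plane onto $\Omega_n(\alpha,\beta)$ with the boundary values $w(0)=\infty_0$, $w(1)=\infty_{n+1}$, $w(\infty)=\infty_{n+2}$; moreover there are real points $\xi_j=w^{-1}(\infty_j)$, $1\le j\le n$ (that is, $w(z)\to\infty_j$ as $z\to\xi_j$), and a real constant $C=C_n(\alpha,\beta)$ such that $$w(z)=(\alpha+\beta+n)\ln z+C-\beta\pi i+O(1/z),\qquad z\to\infty.$$ *Conclusion.* For every such $w$, $\xi_1,\dots,\xi_n$ and $C$, factorize the monic uniform Jacobi polynomial $\tilde{\mathcal J}_n(t;\alpha,\beta)=(t-\xi_1)\cdots(t-\xi_n)$ as $\tilde{\mathcal J}^{(1)}_{l_1}(t)\,\tilde{\mathcal J}^{(2)}_{l_2}(t)$ with $$\tilde{\mathcal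 J}^{(1)}_{l_1}(t)=(t-\xi_1)\cdots(t-\xi_{l_1}),\qquad \tilde{\mathcal J}^{(2)}_{l_2}(t)=(t-\xi_{l_1+1})\cdots(t-\xi_{l_1+l_2}).$$ Then $$e^{C}\,z_1^{k_1-l_1}z_2^{k_2-l_2}\,\tilde{\mathcal J}^{(1)}_{l_1}(|z_1|^2)\,(-1)^{l_2}\tilde{\mathcal J}^{(2)}_{l_2}(1-|z_2|^2)$$ is a normalized polynomial of least deviation from zero on $\mathbb B$ for the monomial $z_1^{k_1}\bar z_1^{l_1}z_2^{k_2}\bar z_2^{l_2}$. -/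

import Mathlib

open Filter Topology

noncomputable section

/-! ### Polynomials of least deviation from zero on the unit ball of `ℂ²` -/

/-- The closed unit ball `𝔹 = {(z₁, z₂) : |z₁|² + |z₂|² ≤ 1}` of `ℂ²`. -/
def unitBall : Set (ℂ × ℂ) := {z | ‖z.1‖ ^ 2 + ‖z.2‖ ^ 2 ≤ 1}

/-- The uniform norm on the unit ball (of a function that is bounded there). -/
def ballNorm (f : ℂ × ℂ → ℂ) : ℝ := sSup ((fun z => ‖f z‖) '' unitBall)

/-- The (not necessarily analytic) polynomial function of `(z₁, z₂)` given by a polynomial in the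
four variables `z₁, z̄₁, z₂, z̄₂`. -/
def evalPoly (P : MvPolynomial (Fin 4) ℂ) (z : ℂ × ℂ) : ℂ :=
  MvPolynomial.eval ![z.1, starRingEnd ℂ z.1, z.2, starRingEnd ℂ z.2] P

/-- The monomial `z₁^k₁ z̄₁^l₁ z₂^k₂ z̄₂^l₂`. -/
def stdMonomial (k₁ l₁ k₂ l₂ : ℕ) (z : ℂ × ℂ) : ℂ :=
  z.1 ^ k₁ * (starRingEnd ℂ z.1) ^ l₁ * (z.2 ^ k₂ * (starRingEnd ℂ z.2) ^ l₂)

/-- `f` is of the form `z₁^k₁ z̄₁^l₁ z₂^k₂ z̄₂^l₂ - P` with a polynomial `P` of total degree less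
than `k₁ + l₁ + k₂ + l₂` (which is assumed positive whenever this is used). -/
def IsMonicPoly (k₁ l₁ k₂ l₂ : ℕ) (f : ℂ × ℂ → ℂ) : Prop :=
  ∃ P : MvPolynomial (Fin 4) ℂ, P.totalDegree < k₁ + l₁ + k₂ + l₂ ∧
    ∀ z, f z = stdMonomial k₁ l₁ k₂ l₂ z - evalPoly P z

/-- The minimal deviation `L`, the infimum of `‖z₁^k₁ z̄₁^l₁ z₂^k₂ z̄₂^l₂ - P‖` over all
polynomials `P` of lower total degree. -/
def minDeviation (k₁ l₁ k₂ l₂ : ℕ) : ℝ :=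
  sInf (ballNorm '' {f | IsMonicPoly k₁ l₁ k₂ l₂ f})

/-- `f = z₁^k₁ z̄₁^l₁ z₂^k₂ z̄₂^l₂ + …` is a polynomial of least deviation from zero on the ball. -/
def IsLeastDeviation (k₁ l₁ k₂ l₂ : ℕ) (f : ℂ × ℂ → ℂ) : Prop :=
  IsMonicPoly k₁ l₁ k₂ l₂ f ∧ ballNorm f = minDeviation k₁ l₁ k₂ l₂

/-- `T = f / ‖f‖` for a polynomial `f = z₁^k₁ z̄₁^l₁ z₂^k₂ z̄₂^l₂ + …` of least deviation from
zero on the ball. -/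
def IsNormalizedLeastDeviation (k₁ l₁ k₂ l₂ : ℕ) (T : ℂ × ℂ → ℂ) : Prop :=
  ∃ f, IsLeastDeviation k₁ l₁ k₂ l₂ f ∧ 0 < ballNorm f ∧ ∀ z, T z = f z / (ballNorm f : ℂ)

/-! ### The comb-like domain and its conformal mapping -/

/-- The open upper half-plane, as a set of complex numbers. -/
def upperHalf : Set ℂ := {z | 0 < z.im}

/-- The domain `Ω_n(α, β)`: the horizontal strip `-β < v / π < α + n` without the `n + 1`
cuts `v / π = j`, `u ≤ 0` for `0 ≤ j ≤ n`. -/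
def combDomain (n : ℕ) (α β : ℝ) : Set ℂ :=
  {w | -β < w.im / Real.pi ∧ w.im / Real.pi < α + n ∧
    ∀ j : ℕ, j ≤ n → ¬ (w.im / Real.pi = j ∧ w.re ≤ 0)}

/-- The infinite point `-∞ + i v`, `a < v / π < b`, given by its neighbourhoods. -/
def leftEnd (a b : ℝ) : Filter ℂ :=
  comap Complex.re atBot ⊓ 𝓟 {w | a < w.im / Real.pi ∧ w.im / Real.pi < b}

/-- The infinite point `∞₀`, that is `-∞ + i v` with `n < v / π < n + α`. For `α = 0` this
half-strip is empty and the point is the tip `n π i` of the uppermost cut. -/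
def endZero (n : ℕ) (α : ℝ) : Filter ℂ :=
  if α = 0 then 𝓝 ((n : ℂ) * (Real.pi : ℂ) * Complex.I) else leftEnd n (n + α)

/-- The infinite point `∞_{n+1}`, that is `-∞ + i v` with `-β < v / π < 0`. For `β = 0` this
half-strip is empty and the point is the tip `0` of the lowermost cut. -/
def endOne (β : ℝ) : Filter ℂ :=
  if β = 0 then 𝓝 (0 : ℂ) else leftEnd (-β) 0

/-- `w` is the conformal mapping of the upper half-plane onto `Ω_n(α, β)` with
`w(0) = ∞₀`, `w(1) = ∞_{n+1}`, `w(∞) = ∞_{n+2}`, the last point being `+∞ + i v`. -/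
structure IsCombMap (n : ℕ) (α β : ℝ) (w : ℂ → ℂ) : Prop where
  differentiableOn : DifferentiableOn ℂ w upperHalf
  bijOn : Set.BijOn w upperHalf (combDomain n α β)
  map_zero : Tendsto w (𝓝[upperHalf] 0) (endZero n α)
  map_one : Tendsto w (𝓝[upperHalf] 1) (endOne β)
  map_infty : Tendsto (fun z => (w z).re) (Bornology.cobounded ℂ ⊓ 𝓟 upperHalf) atTop

/-- `ξ_j = w⁻¹(∞_j)` for `1 ≤ j ≤ n`, where `∞_j` is `-∞ + i v` with
`n - j < v / π < n - j + 1`. (The other values of `ξ` play no role.) -/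
def IsEndPreimages (n : ℕ) (w : ℂ → ℂ) (ξ : ℕ → ℝ) : Prop :=
  ∀ j : ℕ, 1 ≤ j → j ≤ n →
    Tendsto w (𝓝[upperHalf] (ξ j : ℂ)) (leftEnd ((n : ℝ) - j) ((n : ℝ) - j + 1))

/-- `C` is the real constant in `w(z) = (α + β + n) ln z + C - β π i + O(1 / z)`, `z → ∞`. -/
def IsCombConstant (n : ℕ) (α β : ℝ) (w : ℂ → ℂ) (C : ℝ) : Prop :=
  (fun z : ℂ => w z -
      (((α + β + n : ℝ) : ℂ) * Complex.log z + (C : ℂ) - (β : ℂ) * (Real.pi : ℂ) * Complex.I))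
    =O[Bornology.cobounded ℂ ⊓ 𝓟 upperHalf] (fun z : ℂ => z⁻¹)

/-- The product `(t - ξ_{a+1}) ⋯ (t - ξ_b)`. For `a = 0`, `b = n` and `ξ_j = w⁻¹(∞_j)` it is the
monic uniform Jacobi polynomial of degree `n`. -/
def jacobiProd (ξ : ℕ → ℝ) (a b : ℕ) : Polynomial ℝ :=
  ∏ j ∈ Finset.Ioc a b, (Polynomial.X - Polynomial.C (ξ j))

end

/-! The conformal mapping is explicit. Suppose 0 = ξ_0 < ξ_1 < … < ξ_{n+1} = 1 are such that V(x) =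
x^α ∏|x - ξ_j| (1-x)^β has the same maximum e^{-C} on all gaps [ξ_k, ξ_{k+1}]. Such points come from
a weighted Chebyshev problem on [0, 1]: a choice of zeros that minimizes max V must equioscillate
(`exists_weighted_chebyshev`). Put w = C - βπi + α ln z + ∑ ln(z - ξ_j) + β ln(z - 1). On the real
line Im w is a step function and, on [0, 1], Re w = C + ln V ≤ 0. So the gap k is folded onto the
cut of height n - k, and a maximum point of V goes to the tip. Since Im w' < 0, w is injective in
the upper half-plane, and a connectedness argument shows that its image is the whole comb domain
(`isCombMap_logMap`). Any other comb mapping differs from w by an automorphism of the half-plane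
that fixes ∞, hence is affine, and that fixes 0 and 1, hence is the identity. Thus the ξ_j and C of
the theorem are those of the Chebyshev problem.

It remains to prove that the minimal deviation is e^{-C} and is attained by f = z₁^{m₁} z₂^{m₂}
∏_{j≤l₁}(|z₁|² - ξ_j) ∏_{j>l₁}(|z₂|² - (1 - ξ_j)), where m_i = k_i - l_i.

Upper bound: with s = |z₁|² and r = 1 - |z₂|² the ball is the region s ≤ r, and |f| = A(s)B(r) with
A·B = V. Monotonicity of A and B on either side of a maximum point reduces the bound to the diagonal
s = r, that is, to V ≤ e^{-C} (`Equioscillates.split_le`).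

Lower bound, by duality: at n+1 maximum points x_i of V, one in each gap, take the Fourier
coefficient of index (m₁, m₂) over the torus |z₁|² = x_i, |z₂|² = 1 - x_i, and combine these with
the weights of the divided difference of order n. This functional kills all polynomials of lower
degree, has modulus 1 on the leading monomial, and has total mass e^C by equioscillation
(`Equioscillates.exp_le_of_isMonicPoly`). -/

noncomputable section

/-! ### Weighted Chebyshev polynomials on `[0, 1]` -/

/-- A sorted tuple `η` in `[0, 1]`, shifted by one and completed by `0` and `1`. -/
def gapPoint {n : ℕ} (η : Fin n → ℝ) (j : ℕ) : ℝ :=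
  if j = 0 then 0 else if h : j - 1 < n then η ⟨j - 1, h⟩ else 1

theorem gapPoint_zero {n : ℕ} (η : Fin n → ℝ) : gapPoint η 0 = 0 := by simp [gapPoint]

theorem gapPoint_succ {n : ℕ} (η : Fin n → ℝ) (j : ℕ) (h : j < n) :
    gapPoint η (j + 1) = η ⟨j, h⟩ := by simp [gapPoint, h]

theorem gapPoint_last {n : ℕ} (η : Fin n → ℝ) : gapPoint η (n + 1) = 1 := by simp [gapPoint]

/-- Lowering one factor `q` by a small constant decreases the maximum of `R |q|`, if this maximum is
not attained where `q` may be negative. -/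
theorem exists_lowering {K S : Set ℝ} {R q : ℝ → ℝ} {M M' B : ℝ} (hM : 0 < M) (hM' : M' < M)
    (hB : 0 < B) (hR : ∀ x ∈ K, 0 ≤ R x) (hRB : ∀ x ∈ K, R x ≤ B)
    (hle : ∀ x ∈ K, R x * |q x| ≤ M) (hS : ∀ x ∈ K, x ∈ S → R x * |q x| ≤ M')
    (hq : ∀ x ∈ K, x ∉ S → 0 ≤ q x) :
    ∃ δ₀ > 0, ∀ δ, 0 < δ → δ < δ₀ → ∀ x ∈ K, R x * |q x - δ| < M := by
  -- The first bound keeps M' + δB below M on S; the second handles points off S with 0 ≤ q ≤ δ,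
  -- where the new value is at most δB.
  refine ⟨min ((M - M') / B) (M / B), lt_min (div_pos (by linarith) hB) (div_pos hM hB), ?_⟩
  intro δ hδ hlt x hx
  have h1 : δ * B < M - M' := (lt_div_iff₀ hB).1 (hlt.trans_le (min_le_left _ _))
  have h2 : δ * B < M := (lt_div_iff₀ hB).1 (hlt.trans_le (min_le_right _ _))
  have hRx := hR x hx
  have h3 : R x * δ ≤ δ * B := by nlinarith [hRB x hx]
  by_cases hxS : x ∈ S
  · have h4 : |q x - δ| ≤ |q x| + δ := by
      calc |q x - δ| ≤ |q x| + |δ| := abs_sub _ _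
        _ = _ := by rw [abs_of_pos hδ]
    have h5 := hS x hx hxS
    nlinarith [mul_le_mul_of_nonneg_left h4 hRx]
  · have hqx := hq x hx hxS
    have h5 := hle x hx
    rw [abs_of_nonneg hqx] at h5
    rcases le_total δ (q x) with h | h
    · rw [abs_of_nonneg (by linarith)]
      rcases hRx.eq_or_lt with h0 | h0
      · rw [← h0]; simpa using hM
      · nlinarith
    · rw [abs_of_nonpos (by linarith)]
      nlinarith

/-- A minimizer of the maximum over the compact cube of zeros exists. If the maximum M were missed
on some gap, moving the zeros that bound this gap apart would subtract a small constant from a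
factor that is nonnegative outside the gap, and by `exists_lowering` the maximum would drop. Zeros
may coincide at this stage. -/
theorem exists_weighted_chebyshev (W : ℝ → ℝ) (hW : Continuous W) (hW0 : ∀ x, 0 ≤ W x)
    (hWpos : ∀ x, 0 < x → x < 1 → 0 < W x) (n : ℕ) :
    ∃ (η : Fin n → ℝ) (M : ℝ), 0 < M ∧ Monotone η ∧ (∀ i, η i ∈ Set.Icc (0 : ℝ) 1) ∧
      (∀ x ∈ Set.Icc (0 : ℝ) 1, W x * ∏ i, |x - η i| ≤ M) ∧
      ∀ k ≤ n, ∃ x ∈ Set.Icc (gapPoint η k) (gapPoint η (k + 1)), W x * ∏ i, |x - η i| = M := by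
  set K : Set ℝ := Set.Icc (0 : ℝ) 1 with hK
  have hKc : IsCompact K := isCompact_Icc
  have hKne : K.Nonempty := ⟨0, by simp [hK]⟩
  let G : (Fin n → ℝ) → ℝ → ℝ := fun η x => W x * ∏ i, |x - η i|
  have hGc : Continuous ↿G := by
    change Continuous fun p : (Fin n → ℝ) × ℝ => W p.2 * ∏ i, |p.2 - p.1 i|
    fun_prop
  have hGx : ∀ η, Continuous (G η) := fun η => by
    change Continuous fun x => W x * ∏ i, |x - η i|
    fun_prop
  have hFc := hKc.continuous_sSup hGc
  obtain ⟨η₀, hη₀, hmin⟩ := (isCompact_univ_pi (fun _ : Fin n => hKc)).exists_isMinOn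
    ⟨fun _ => 0, fun _ _ => by simp [hK]⟩ hFc.continuousOn
  -- The product is symmetric in the zeros, so the minimizer may be sorted.
  set η : Fin n → ℝ := η₀ ∘ Tuple.sort η₀ with hη
  have hmono : Monotone η := Tuple.monotone_sort η₀
  have hηK : ∀ i, η i ∈ K := fun i => hη₀ _ (Set.mem_univ _)
  have hGη : G η = G η₀ := by
    funext x
    simp only [G, hη, Function.comp]
    rw [Equiv.prod_comp (Tuple.sort η₀) (fun i => |x - η₀ i|)]
  obtain ⟨y, hyK, hyM⟩ := hKc.exists_isMaxOn hKne (hGx η).continuousOn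
  set M := G η y with hMdef
  have hle : ∀ x ∈ K, G η x ≤ M := fun x hx => hyM hx
  have hbdd : ∀ ζ, BddAbove (G ζ '' K) := fun ζ => (hKc.image (hGx ζ)).bddAbove
  have hMs : M ≤ sSup (G η₀ '' K) := by
    rw [← hGη]; exact le_csSup (hbdd η) ⟨y, hyK, rfl⟩
  have hopt : ∀ ζ : Fin n → ℝ, (∀ i, ζ i ∈ K) → ¬ ∀ x ∈ K, G ζ x < M := by
    intro ζ hζ hlt
    obtain ⟨x, hx, hxe⟩ := hKc.exists_sSup_image_eq hKne (hGx ζ).continuousOn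
    have h1 := hmin (Set.mem_univ_pi.2 hζ)
    have h2 : sSup (G η₀ '' K) ≤ sSup (G ζ '' K) := h1
    rw [hxe] at h2
    linarith [hlt x hx]
  have hMpos : 0 < M := by
    obtain ⟨x, hx, hxn⟩ := (Set.Ioo_infinite (zero_lt_one' ℝ)).exists_notMem_finite
      (Set.finite_range η)
    refine lt_of_lt_of_le ?_ (hle x ⟨hx.1.le, hx.2.le⟩)
    refine mul_pos (hWpos x hx.1 hx.2) (Finset.prod_pos fun i _ => abs_pos.2 ?_)
    exact sub_ne_zero.2 fun h => hxn ⟨i, h.symm⟩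
  -- the lowering argument, for a factor `q` that is free to move
  have key : ∀ (a b : ℝ) (R q : ℝ → ℝ), Continuous R → (∀ x, 0 ≤ R x) →
      (∀ x, G η x = R x * |q x|) → (∀ x ∈ K, x ∉ Set.Icc a b → 0 ≤ q x) →
      (∀ x ∈ Set.Icc a b, G η x ≠ M) → Set.Icc a b ⊆ K → a ≤ b →
      ∃ δ₀ > 0, ∀ δ, 0 < δ → δ < δ₀ → ∀ x ∈ K, R x * |q x - δ| < M := by
    intro a b R q hRc hR0 hG hq hne hsub hab
    obtain ⟨z, hz, hzm⟩ := (isCompact_Icc (a := a) (b := b)).exists_isMaxOn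
      ⟨a, by simp [hab]⟩ (hGx η).continuousOn
    obtain ⟨B, hB⟩ := (hKc.image hRc).bddAbove
    refine exists_lowering (S := Set.Icc a b) (M' := G η z) (B := max B 1) hMpos
      (lt_of_le_of_ne (hle z (hsub hz)) (hne z hz)) (by positivity) (fun x _ => hR0 x)
      (fun x hx => (hB ⟨x, hx, rfl⟩).trans (le_max_left _ _)) ?_ ?_ hq
    · intro x hx; rw [← hG]; exact hle x hx
    · intro x _ hxS; rw [← hG]; exact hzm hxS
  have hfac : ∀ (ζ : Fin n → ℝ) (i : Fin n) (x : ℝ), G ζ x =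
      (W x * ∏ j ∈ Finset.univ.erase i, |x - ζ j|) * |x - ζ i| := by
    intro ζ i x
    simp only [G]
    rw [← Finset.mul_prod_erase _ _ (Finset.mem_univ i)]; ring
  have hrest : ∀ s : Finset (Fin n), Continuous (fun x => W x * ∏ j ∈ s, |x - η j|) ∧
      ∀ x, 0 ≤ W x * ∏ j ∈ s, |x - η j| := by
    refine fun s => ⟨by fun_prop, fun x => mul_nonneg (hW0 x) (Finset.prod_nonneg fun _ _ =>
      abs_nonneg _)⟩
  have hfirst : ∀ h : 0 < n, ∃ x ∈ Set.Icc 0 (η ⟨0, h⟩), G η x = M := by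
    intro h
    by_contra! hne
    set i : Fin n := ⟨0, h⟩
    -- There is room to move the first zero to the right: otherwise the first gap is all of [0, 1]
    -- and contains the maximum point `y`.
    have h1 : η i < 1 := by
      by_contra! h1
      exact hne y ⟨hyK.1, hyK.2.trans h1⟩ rfl
    obtain ⟨δ₀, hδ₀, hlow⟩ := key 0 (η i) _ (fun x => x - η i) (hrest _).1 (hrest _).2
      (hfac η i) (fun x hx hxS => by
        by_contra! hlt
        exact hxS ⟨hx.1, by linarith⟩) hne (Set.Icc_subset_Icc le_rfl h1.le) (hηK i).1
    obtain ⟨δ, hδ, hδ'⟩ := exists_between (lt_min hδ₀ (sub_pos.2 h1))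
    refine hopt (Function.update η i (η i + δ)) ?_ ?_
    · intro j
      rcases eq_or_ne j i with rfl | hj
      · rw [Function.update_self]
        exact ⟨by linarith [(hηK i).1], by linarith [min_le_right δ₀ (1 - η i)]⟩
      · rw [Function.update_of_ne hj]; exact hηK j
    · intro x hx
      rw [hfac _ i, Function.update_self]
      have h2 := hlow δ hδ (hδ'.trans_le (min_le_left _ _)) x hx
      have h3 : ∏ j ∈ Finset.univ.erase i, |x - Function.update η i (η i + δ) j| =
          ∏ j ∈ Finset.univ.erase i, |x - η j| :=
        Finset.prod_congr rfl fun j hj => by rw [Function.update_of_ne (Finset.ne_of_mem_erase hj)]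
      rw [h3]
      convert h2 using 3
      ring
  have hlast : ∀ h : n - 1 < n, ∃ x ∈ Set.Icc (η ⟨n - 1, h⟩) 1, G η x = M := by
    intro h
    by_contra! hne
    set i : Fin n := ⟨n - 1, h⟩
    have h1 : 0 < η i := by
      by_contra! h1
      exact hne y ⟨h1.trans hyK.1, hyK.2⟩ rfl
    obtain ⟨δ₀, hδ₀, hlow⟩ := key (η i) 1 _ (fun x => η i - x) (hrest _).1 (hrest _).2
      (fun x => by rw [abs_sub_comm]; exact hfac η i x) (fun x hx hxS => by
        by_contra! hlt
        exact hxS ⟨by linarith, hx.2⟩) hne (Set.Icc_subset_Icc h1.le le_rfl) (hηK i).2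
    obtain ⟨δ, hδ, hδ'⟩ := exists_between (lt_min hδ₀ h1)
    refine hopt (Function.update η i (η i - δ)) ?_ ?_
    · intro j
      rcases eq_or_ne j i with rfl | hj
      · rw [Function.update_self]
        exact ⟨by linarith [min_le_right δ₀ (η i)], by linarith [(hηK i).2]⟩
      · rw [Function.update_of_ne hj]; exact hηK j
    · intro x hx
      rw [hfac _ i, Function.update_self]
      have h2 := hlow δ hδ (hδ'.trans_le (min_le_left _ _)) x hx
      have h3 : ∏ j ∈ Finset.univ.erase i, |x - Function.update η i (η i - δ) j| =
          ∏ j ∈ Finset.univ.erase i, |x - η j| :=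
        Finset.prod_congr rfl fun j hj => by rw [Function.update_of_ne (Finset.ne_of_mem_erase hj)]
      rw [h3, abs_sub_comm]
      convert h2 using 3
      ring
  have hzero : ∀ i, G η (η i) = 0 := fun i => by rw [hfac η i]; simp
  have hmiddle : ∀ (k : ℕ) (h : k + 1 < n),
      ∃ x ∈ Set.Icc (η ⟨k, by omega⟩) (η ⟨k + 1, h⟩), G η x = M := by
    intro k h
    by_contra! hne
    set i : Fin n := ⟨k, by omega⟩ with hi
    set j : Fin n := ⟨k + 1, h⟩ with hj
    have hij : i ≠ j := by simp [hi, hj, Fin.ext_iff]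
    have hle' : η i ≤ η j := hmono (by simp [hi, hj, Fin.le_def])
    -- If the left zero were 0, the first gap would shrink to this zero, where the product vanishes
    -- and cannot equal M.
    have h0 : 0 < η i := by
      by_contra! h0
      obtain ⟨x, hx, hxM⟩ := hfirst (by omega)
      have h1 : η ⟨0, by omega⟩ ≤ η i := hmono (by simp [hi, Fin.le_def])
      have h2 := hx.1; have h3 := hx.2
      have h4 : x = η i := by linarith
      rw [h4, hzero] at hxM
      linarith
    have h1 : η j < 1 := by
      by_contra! h0
      obtain ⟨x, hx, hxM⟩ := hlast (by omega)
      have h1 : η j ≤ η ⟨n - 1, by omega⟩ := hmono (by simp only [hj, Fin.le_def]; omega)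
      have h2 := hx.1; have h3 := hx.2
      have h4 : x = η j := by linarith
      rw [h4, hzero] at hxM
      linarith
    have hfac2 : ∀ (ζ : Fin n → ℝ) (x : ℝ), G ζ x =
        (W x * ∏ l ∈ (Finset.univ.erase i).erase j, |x - ζ l|) *
          |(x - ζ i) * (x - ζ j)| := by
      intro ζ x
      rw [hfac ζ i, ← Finset.mul_prod_erase (Finset.univ.erase i) _
        (Finset.mem_erase.2 ⟨hij.symm, Finset.mem_univ j⟩), abs_mul]
      ring
    obtain ⟨δ₀, hδ₀, hlow⟩ := key (η i) (η j) _ (fun x => (x - η i) * (x - η j)) (hrest _).1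
      (hrest _).2 (hfac2 η) (fun x hx hxS => by
        rcases lt_or_ge x (η i) with h | h
        · exact mul_nonneg_of_nonpos_of_nonpos (by linarith) (by linarith)
        · rcases le_or_gt x (η j) with h' | h'
          · exact absurd ⟨h, h'⟩ hxS
          · exact mul_nonneg (by linarith) (by linarith)) hne
      (Set.Icc_subset_Icc h0.le h1.le) hle'
    -- With ε < 1 and η_j - η_i ≤ 1 the lowering constant ε(η_j - η_i) + ε² is below 2ε < δ₀; the
    -- other two bounds keep the moved zeros in [0, 1].
    obtain ⟨ε, hε, hε'⟩ := exists_between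
      (lt_min (lt_min (half_pos hδ₀) (zero_lt_one' ℝ)) (lt_min h0 (sub_pos.2 h1)))
    have hε1 := hε'.trans_le ((min_le_left _ _).trans (min_le_left _ _))
    have hε2 := hε'.trans_le ((min_le_left _ _).trans (min_le_right _ _))
    have hε3 := hε'.trans_le ((min_le_right _ _).trans (min_le_left _ _))
    have hε4 := hε'.trans_le ((min_le_right _ _).trans (min_le_right _ _))
    set ζ : Fin n → ℝ := Function.update (Function.update η i (η i - ε)) j (η j + ε) with hζ
    have hζi : ζ i = η i - ε := by
      rw [hζ, Function.update_of_ne hij, Function.update_self]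
    have hζj : ζ j = η j + ε := by rw [hζ, Function.update_self]
    have hζl : ∀ l, l ≠ i → l ≠ j → ζ l = η l := by
      intro l h1 h2
      rw [hζ, Function.update_of_ne h2, Function.update_of_ne h1]
    refine hopt ζ ?_ ?_
    · intro l
      rcases eq_or_ne l i with hli | hli
      · rw [hli, hζi]; exact ⟨by linarith, by linarith [(hηK i).2]⟩
      rcases eq_or_ne l j with hlj | hlj
      · rw [hlj, hζj]; exact ⟨by linarith [(hηK j).1], by linarith⟩
      rw [hζl l hli hlj]; exact hηK l
    · intro x hx
      rw [hfac2, hζi, hζj]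
      -- Moving both zeros outwards by ε changes (x - η_i)(x - η_j) by exactly this constant.
      have h2 := hlow (ε * (η j - η i) + ε ^ 2)
        (by nlinarith [mul_nonneg hε.le (sub_nonneg.2 hle')]) (by nlinarith) x hx
      have h3 : ∏ l ∈ (Finset.univ.erase i).erase j, |x - ζ l| =
          ∏ l ∈ (Finset.univ.erase i).erase j, |x - η l| :=
        Finset.prod_congr rfl fun l hl => by
          rw [hζl l (Finset.ne_of_mem_erase (Finset.mem_of_mem_erase hl))
            (Finset.ne_of_mem_erase hl)]
      rw [h3]
      convert h2 using 3
      ring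
  refine ⟨η, M, hMpos, hmono, hηK, hle, ?_⟩
  intro k hk
  rcases Nat.eq_zero_or_pos n with hn | hn
  · subst hn
    obtain rfl : k = 0 := by omega
    refine ⟨y, ?_, rfl⟩
    simpa [gapPoint, hK] using hyK
  rcases Nat.eq_zero_or_pos k with hk0 | hk0
  · subst hk0
    rw [gapPoint_zero, gapPoint_succ η 0 hn]
    exact hfirst hn
  obtain ⟨m, rfl⟩ : ∃ m, k = m + 1 := ⟨k - 1, by omega⟩
  rw [gapPoint_succ η m (by omega)]
  rcases hk.eq_or_lt with hkn | hkn
  · have := hlast (by omega)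
    subst hkn
    rw [gapPoint_last]
    exact this
  · rw [gapPoint_succ η (m + 1) hkn]
    exact hmiddle m hkn

/-! ### The equioscillating product -/

/-- The exponents `α, 1, …, 1, β` at the points `0, ξ₁, …, ξₙ, 1`. -/
def endWeight (n : ℕ) (α β : ℝ) (j : ℕ) : ℝ := if j = 0 then α else if j = n + 1 then β else 1

/-- The product `|x|^α |x - ξ₁| ⋯ |x - ξₙ| |x - 1|^β`, if `ξ 0 = 0` and `ξ (n + 1) = 1`. -/
def weightedProd (n : ℕ) (α β : ℝ) (ξ : ℕ → ℝ) (x : ℝ) : ℝ :=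
  ∏ j ∈ Finset.range (n + 2), |x - ξ j| ^ endWeight n α β j

/-- The points `0 = ξ₀ < ξ₁ < ⋯ < ξₙ₊₁ = 1` are such that the weighted product has the same
maximum `e^{-C}` on all the intervals between them. -/
structure Equioscillates (n : ℕ) (α β : ℝ) (ξ : ℕ → ℝ) (C : ℝ) : Prop where
  zero : ξ 0 = 0
  last : ξ (n + 1) = 1
  lt : ∀ j ≤ n, ξ j < ξ (j + 1)
  le_exp : ∀ x ∈ Set.Icc (0 : ℝ) 1, weightedProd n α β ξ x ≤ Real.exp (-C)
  exists_eq : ∀ k ≤ n, ∃ x ∈ Set.Icc (ξ k) (ξ (k + 1)), weightedProd n α β ξ x = Real.exp (-C)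

theorem endWeight_zero (n : ℕ) (α β : ℝ) : endWeight n α β 0 = α := by simp [endWeight]

theorem endWeight_last (n : ℕ) (α β : ℝ) : endWeight n α β (n + 1) = β := by simp [endWeight]

theorem endWeight_of_mem {n : ℕ} (α β : ℝ) {j : ℕ} (h1 : 1 ≤ j) (h2 : j ≤ n) :
    endWeight n α β j = 1 := by
  rw [endWeight, if_neg (by omega), if_neg (by omega)]

theorem endWeight_nonneg {n : ℕ} {α β : ℝ} (hα : 0 ≤ α) (hβ : 0 ≤ β) (j : ℕ) :
    0 ≤ endWeight n α β j := by
  unfold endWeight; split_ifs <;> first | assumption | norm_num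

theorem weightedProd_continuous {n : ℕ} {α β : ℝ} (hα : 0 ≤ α) (hβ : 0 ≤ β) (ξ : ℕ → ℝ) :
    Continuous (weightedProd n α β ξ) :=
  continuous_finsetProd _ fun j _ =>
    (continuous_id.sub continuous_const).abs.rpow_const fun _ => Or.inr (endWeight_nonneg hα hβ j)

theorem weightedProd_eq {n : ℕ} {α β : ℝ} {ξ : ℕ → ℝ} (h0 : ξ 0 = 0) (h1 : ξ (n + 1) = 1)
    (x : ℝ) : weightedProd n α β ξ x =
      |x| ^ α * |1 - x| ^ β * ∏ j ∈ Finset.Ioc 0 n, |x - ξ j| := by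
  have h : Finset.Ioc 0 n = (Finset.range n).image (· + 1) := by
    ext j; simp only [Finset.mem_Ioc, Finset.mem_image, Finset.mem_range]
    exact ⟨fun h => ⟨j - 1, by omega, by omega⟩, by rintro ⟨i, hi, rfl⟩; omega⟩
  rw [weightedProd, Finset.prod_range_succ, Finset.prod_range_succ', h,
    Finset.prod_image (by intro a _ b _ h; exact Nat.succ_injective h), endWeight_zero,
    endWeight_last, h0, h1, sub_zero, abs_sub_comm x 1]
  have : ∏ j ∈ Finset.range n, |x - ξ (j + 1)| ^ endWeight n α β (j + 1) =
      ∏ j ∈ Finset.range n, |x - ξ (j + 1)| :=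
    Finset.prod_congr rfl fun j hj => by
      rw [endWeight_of_mem α β (by omega) (by have := Finset.mem_range.1 hj; omega), Real.rpow_one]
  rw [this]; ring

theorem exists_equioscillates (n : ℕ) {α β : ℝ} (hα : 0 ≤ α) (hβ : 0 ≤ β) :
    ∃ ξ C, Equioscillates n α β ξ C := by
  obtain ⟨η, M, hM, hmono, hηK, hle, hex⟩ := exists_weighted_chebyshev
    (fun x => |x| ^ α * |1 - x| ^ β)
    ((continuous_abs.rpow_const fun _ => Or.inr hα).mul
      ((continuous_const.sub continuous_id).abs.rpow_const fun _ => Or.inr hβ))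
    (fun x => by positivity)
    (fun x h0 h1 => mul_pos (Real.rpow_pos_of_pos (abs_pos.2 h0.ne') _)
      (Real.rpow_pos_of_pos (abs_pos.2 (by linarith)) _)) n
  have hprod : ∀ x, weightedProd n α β (gapPoint η) x =
      |x| ^ α * |1 - x| ^ β * ∏ i, |x - η i| := by
    intro x
    rw [weightedProd_eq (gapPoint_zero η) (gapPoint_last η)]
    congr 1
    have h : Finset.Ioc 0 n = (Finset.range n).image (· + 1) := by
      ext j; simp only [Finset.mem_Ioc, Finset.mem_image, Finset.mem_range]
      exact ⟨fun h => ⟨j - 1, by omega, by omega⟩, by rintro ⟨i, hi, rfl⟩; omega⟩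
    rw [h, Finset.prod_image (by intro a _ b _ h; exact Nat.succ_injective h),
      Finset.prod_range]
    exact Finset.prod_congr rfl fun i _ => by rw [gapPoint_succ η i i.2]
  have hexp : Real.exp (-(-Real.log M)) = M := by rw [neg_neg, Real.exp_log hM]
  refine ⟨gapPoint η, -Real.log M, gapPoint_zero η, gapPoint_last η, ?_, ?_, ?_⟩
  · intro j hj
    rw [lt_iff_le_and_ne]
    refine ⟨?_, fun h => ?_⟩
    · obtain ⟨x, hx, -⟩ := hex j hj
      exact hx.1.trans hx.2
    -- A degenerate gap would have its maximum point at one of the zeros, contradicting M > 0; for n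
    -- = 0 the only gap is [0, 1].
    · obtain ⟨x, hx, hxM⟩ := hex j hj
      rcases Nat.eq_zero_or_pos n with hn | hn
      · subst hn
        obtain rfl : j = 0 := by omega
        simp [gapPoint] at h
      obtain ⟨i, hi⟩ : ∃ i, x = η i := by
        rcases Nat.eq_zero_or_pos j with h0 | h0
        · subst h0
          rw [gapPoint_succ η 0 hn] at hx h
          exact ⟨⟨0, hn⟩, le_antisymm hx.2 (h ▸ hx.1)⟩
        · obtain ⟨m, rfl⟩ : ∃ m, j = m + 1 := ⟨j - 1, by omega⟩
          rw [gapPoint_succ η m (by omega)] at hx h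
          exact ⟨⟨m, by omega⟩, le_antisymm (h ▸ hx.2) hx.1⟩
      rw [Finset.prod_eq_zero (Finset.mem_univ i) (by simp [hi])] at hxM
      simp at hxM
      exact hM.ne hxM
  · intro x hx
    rw [hexp, hprod]; exact hle x hx
  · intro k hk
    obtain ⟨x, hx, hxM⟩ := hex k hk
    exact ⟨x, hx, by rw [hexp, hprod]; exact hxM⟩

/-! ### The conformal mapping as a sum of logarithms -/

/-- The sum of logarithms `C - βπi + α ln z + ∑ ln (z - ξ_j) + β ln (z - 1)`. -/
def logMap (n : ℕ) (α β : ℝ) (ξ : ℕ → ℝ) (C : ℝ) (z : ℂ) : ℂ :=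
  (C : ℂ) - (β : ℂ) * (Real.pi : ℂ) * Complex.I +
    ∑ j ∈ Finset.range (n + 2), (endWeight n α β j : ℂ) * Complex.log (z - ξ j)

variable {n : ℕ} {α β : ℝ} {ξ : ℕ → ℝ} {C : ℝ}

theorem isOpen_upperHalf : IsOpen upperHalf := isOpen_lt continuous_const Complex.continuous_im

theorem convex_upperHalf : Convex ℝ upperHalf := convex_halfSpace_im_gt 0

theorem logMap_re (z : ℂ) : (logMap n α β ξ C z).re =
    C + ∑ j ∈ Finset.range (n + 2), endWeight n α β j * Real.log ‖z - ξ j‖ := by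
  simp [logMap, Complex.log_re]

theorem logMap_im (z : ℂ) : (logMap n α β ξ C z).im =
    -β * Real.pi + ∑ j ∈ Finset.range (n + 2), endWeight n α β j * Complex.arg (z - ξ j) := by
  simp [logMap, Complex.log_im]

theorem sum_endWeight (n : ℕ) (α β : ℝ) :
    ∑ j ∈ Finset.range (n + 2), endWeight n α β j = α + β + n := by
  rw [Finset.sum_range_succ, Finset.sum_range_succ', endWeight_zero, endWeight_last,
    Finset.sum_congr rfl (g := fun _ => (1 : ℝ)) fun j hj => endWeight_of_mem α β (by omega)
      (by have := Finset.mem_range.1 hj; omega)]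
  simp; ring

/-- Total exponent of the points to the right of the k-th gap. Each of them contributes its exponent
times π to the imaginary part there. -/
theorem sum_endWeight_tail {k : ℕ} (hk : k ≤ n) :
    ∑ j ∈ Finset.range (n + 2), endWeight n α β j * (if k < j then 1 else 0) = n - k + β := by
  rw [Finset.sum_range_succ, Finset.sum_range_succ', endWeight_last,
    Finset.sum_congr rfl (g := fun j => if k ≤ j then (1 : ℝ) else 0) fun j hj => by
      rw [endWeight_of_mem α β (by omega) (by have := Finset.mem_range.1 hj; omega), one_mul]
      simp]
  have h : (Finset.range n).filter (fun j => k ≤ j) = Finset.Ico k n := by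
    ext j; simp; tauto
  rw [Finset.sum_boole, h, Nat.card_Ico, Nat.cast_sub hk]
  simp [hk]

theorem Equioscillates.lt_of_lt (E : Equioscillates n α β ξ C) {i j : ℕ} (hij : i < j)
    (hj : j ≤ n + 1) : ξ i < ξ j := by
  induction j, hij using Nat.le_induction with
  | base => exact E.lt i (by omega)
  | succ m hm ih => exact (ih (by omega)).trans (E.lt m (by omega))

theorem Equioscillates.le_of_le (E : Equioscillates n α β ξ C) {i j : ℕ} (hij : i ≤ j)
    (hj : j ≤ n + 1) : ξ i ≤ ξ j := by
  rcases hij.eq_or_lt with rfl | h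
  · exact le_rfl
  · exact (E.lt_of_lt h hj).le

theorem Equioscillates.mem_Icc (E : Equioscillates n α β ξ C) {j : ℕ} (hj : j ≤ n + 1) :
    ξ j ∈ Set.Icc (0 : ℝ) 1 :=
  ⟨E.zero ▸ E.le_of_le (Nat.zero_le j) hj, E.last ▸ E.le_of_le hj le_rfl⟩

theorem Equioscillates.exists_gap (E : Equioscillates n α β ξ C) {x : ℝ} (h0 : 0 ≤ x)
    (h1 : x < 1) : ∃ k ≤ n, ξ k ≤ x ∧ x < ξ (k + 1) := by
  have : ∀ m ≤ n, x < ξ (m + 1) → ∃ k ≤ n, ξ k ≤ x ∧ x < ξ (k + 1) := by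
    intro m
    induction m with
    | zero => exact fun _ h => ⟨0, by omega, by rw [E.zero]; exact h0, h⟩
    | succ m ih =>
      intro hm h
      rcases le_or_gt (ξ (m + 1)) x with h' | h'
      · exact ⟨m + 1, hm, h', h⟩
      · exact ih (by omega) h'
  exact this n le_rfl (by rw [E.last]; exact h1)

theorem arg_mem_Ioo {z : ℂ} (hz : z ∈ upperHalf) (x : ℝ) :
    0 < Complex.arg (z - x) ∧ Complex.arg (z - x) < Real.pi := by
  have hz' : 0 < (z - x).im := by simpa [upperHalf] using hz
  refine ⟨lt_of_le_of_ne (Complex.arg_nonneg_iff.2 hz'.le) fun h => ?_,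
    Complex.arg_lt_pi_iff.2 (Or.inr hz'.ne')⟩
  exact hz'.ne' (Complex.arg_eq_zero_iff.1 h.symm).2

theorem exists_endWeight_pos (hpos : 0 < α + β + n) :
    ∃ j ∈ Finset.range (n + 2), 0 < endWeight n α β j := by
  by_contra! h
  have := Finset.sum_nonpos h
  rw [sum_endWeight] at this
  linarith

/-- All arguments lie strictly between 0 and π, and the nonnegative exponents have positive sum α +
β + n. -/
theorem logMap_im_mem (hα : 0 ≤ α) (hβ : 0 ≤ β) (hpos : 0 < α + β + n) {z : ℂ}
    (hz : z ∈ upperHalf) : -β < (logMap n α β ξ C z).im / Real.pi ∧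
      (logMap n α β ξ C z).im / Real.pi < α + n := by
  obtain ⟨i, hi, hi0⟩ := exists_endWeight_pos hpos
  rw [lt_div_iff₀ Real.pi_pos, div_lt_iff₀ Real.pi_pos, logMap_im]
  constructor
  · have : 0 < ∑ j ∈ Finset.range (n + 2), endWeight n α β j * Complex.arg (z - ξ j) :=
      Finset.sum_pos' (fun j _ => mul_nonneg (endWeight_nonneg hα hβ j) (arg_mem_Ioo hz _).1.le)
        ⟨i, hi, mul_pos hi0 (arg_mem_Ioo hz _).1⟩
    linarith
  · have : ∑ j ∈ Finset.range (n + 2), endWeight n α β j * Complex.arg (z - ξ j) <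
        ∑ j ∈ Finset.range (n + 2), endWeight n α β j * Real.pi :=
      Finset.sum_lt_sum (fun j _ => mul_le_mul_of_nonneg_left (arg_mem_Ioo hz _).2.le
        (endWeight_nonneg hα hβ j)) ⟨i, hi, mul_lt_mul_of_pos_left (arg_mem_Ioo hz _).2 hi0⟩
    rw [← Finset.sum_mul, sum_endWeight] at this
    linarith

theorem sub_ofReal_mem_slitPlane {z : ℂ} (hz : z ∈ upperHalf) (x : ℝ) :
    z - x ∈ Complex.slitPlane := by
  refine Or.inr ?_
  have : 0 < z.im := hz
  simpa using this.ne'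

theorem hasDerivAt_logMap {z : ℂ} (hz : z ∈ upperHalf) : HasDerivAt (logMap n α β ξ C)
    (∑ j ∈ Finset.range (n + 2), (endWeight n α β j : ℂ) * (z - ξ j)⁻¹) z := by
  refine (HasDerivAt.fun_sum fun j _ => ?_).const_add _
  have h := (((hasDerivAt_id z).sub_const (ξ j : ℂ)).clog
    (sub_ofReal_mem_slitPlane hz (ξ j))).const_mul (endWeight n α β j : ℂ)
  simpa using h

/-- Inversion maps the upper half-plane to the lower one, and a nonnegative combination, not all of
whose coefficients vanish, stays there. This gives both injectivity and openness. -/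
theorem deriv_logMap_im_neg (hα : 0 ≤ α) (hβ : 0 ≤ β) (hpos : 0 < α + β + n) {z : ℂ}
    (hz : z ∈ upperHalf) :
    (∑ j ∈ Finset.range (n + 2), (endWeight n α β j : ℂ) * (z - ξ j)⁻¹).im < 0 := by
  obtain ⟨i, hi, hi0⟩ := exists_endWeight_pos hpos
  have hneg : ∀ x : ℝ, ((z - x)⁻¹).im < 0 := by
    intro x
    have hz' : 0 < (z - x).im := by simpa [upperHalf] using hz
    rw [Complex.inv_im]
    refine div_neg_of_neg_of_pos (by linarith) (Complex.normSq_pos.2 ?_)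
    rintro h
    rw [h] at hz'
    simp at hz'
  rw [Complex.im_sum]
  simp only [Complex.im_ofReal_mul]
  exact Finset.sum_neg' (fun j _ => mul_nonpos_of_nonneg_of_nonpos (endWeight_nonneg hα hβ j)
    (hneg _).le) ⟨i, hi, mul_neg_of_pos_of_neg hi0 (hneg _)⟩

/-- A holomorphic function on a convex set whose derivative has negative imaginary part is
injective. -/
theorem injOn_of_deriv_im_neg {U : Set ℂ} (hU : Convex ℝ U) {f f' : ℂ → ℂ}
    (hf : ∀ z ∈ U, HasDerivAt f (f' z) z) (hneg : ∀ z ∈ U, (f' z).im < 0) : Set.InjOn f U := by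
  intro a ha b hb hab
  by_contra hne
  have hd : b - a ≠ 0 := sub_ne_zero.2 (Ne.symm hne)
  have hmem : ∀ t ∈ Set.Icc (0 : ℝ) 1, a + t * (b - a) ∈ U := by
    intro t ht
    have := hU.add_smul_sub_mem ha hb ht
    simpa using this
  -- After division by b - a, the derivative along the segment is f' itself, so the mean value
  -- theorem for the imaginary part makes Im f' vanish somewhere if f(a) = f(b).
  have hder : ∀ t ∈ Set.Icc (0 : ℝ) 1,
      HasDerivAt (fun t : ℝ => (f (a + t * (b - a)) / (b - a)).im) (f' (a + t * (b - a))).im t := by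
    intro t ht
    have h1 : HasDerivAt (fun s : ℂ => a + s * (b - a)) (b - a) (t : ℂ) := by
      simpa using ((hasDerivAt_id (t : ℂ)).mul_const (b - a)).const_add a
    have h2 := ((hf _ (hmem t ht)).comp (t : ℂ) h1).div_const (b - a)
    rw [mul_div_assoc, div_self hd, mul_one] at h2
    have h3 := h2.comp_ofReal
    have h4 := Complex.imCLM.hasFDerivAt.comp_hasDerivAt t h3
    simpa using! h4
  obtain ⟨c, hc, hc'⟩ := exists_hasDerivAt_eq_slope
    (fun t : ℝ => (f (a + t * (b - a)) / (b - a)).im) (fun t => (f' (a + t * (b - a))).im)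
    zero_lt_one (fun t ht => (hder t ht).continuousAt.continuousWithinAt)
    (fun t ht => hder t ⟨ht.1.le, ht.2.le⟩)
  have := hneg _ (hmem c ⟨hc.1.le, hc.2.le⟩)
  rw [hc'] at this
  simp [hab] at this

theorem logMap_injOn (hα : 0 ≤ α) (hβ : 0 ≤ β) (hpos : 0 < α + β + n) :
    Set.InjOn (logMap n α β ξ C) upperHalf :=
  injOn_of_deriv_im_neg convex_upperHalf (fun _ hz => hasDerivAt_logMap hz)
    fun _ hz => deriv_logMap_im_neg hα hβ hpos hz

theorem differentiableOn_logMap : DifferentiableOn ℂ (logMap n α β ξ C) upperHalf :=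
  fun _ hz => (hasDerivAt_logMap hz).differentiableAt.differentiableWithinAt

theorem hasStrictDerivAt_logMap {z : ℂ} (hz : z ∈ upperHalf) : HasStrictDerivAt (logMap n α β ξ C)
    (∑ j ∈ Finset.range (n + 2), (endWeight n α β j : ℂ) * (z - ξ j)⁻¹) z := by
  have h := (differentiableOn_logMap (n := n) (α := α) (β := β) (ξ := ξ) (C := C)).analyticAt
    (isOpen_upperHalf.mem_nhds hz)
  have h2 := h.hasStrictDerivAt
  rwa [(hasDerivAt_logMap hz).deriv] at h2

theorem map_nhds_logMap (hα : 0 ≤ α) (hβ : 0 ≤ β) (hpos : 0 < α + β + n) {z : ℂ}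
    (hz : z ∈ upperHalf) : map (logMap n α β ξ C) (𝓝 z) = 𝓝 (logMap n α β ξ C z) :=
  (hasStrictDerivAt_logMap hz).map_nhds_eq fun h => by
    have := deriv_logMap_im_neg (ξ := ξ) hα hβ hpos hz
    rw [h] at this
    simp at this

/-! ### Boundary values -/

theorem ne_of_weightedProd_ne_zero {x : ℝ} (hx : weightedProd n α β ξ x ≠ 0) {j : ℕ}
    (hj : j ∈ Finset.range (n + 2)) : endWeight n α β j = 0 ∨ x ≠ ξ j := by
  by_contra! h
  refine hx (Finset.prod_eq_zero hj ?_)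
  rw [h.2, sub_self, abs_zero, Real.zero_rpow h.1]

theorem exists_of_weightedProd_eq_zero {x : ℝ} (hx : weightedProd n α β ξ x = 0) :
    ∃ k ≤ n + 1, endWeight n α β k ≠ 0 ∧ x = ξ k := by
  obtain ⟨k, hk, h⟩ := Finset.prod_eq_zero_iff.1 hx
  rw [Real.rpow_eq_zero_iff_of_nonneg (abs_nonneg _), abs_eq_zero, sub_eq_zero] at h
  exact ⟨k, by have := Finset.mem_range.1 hk; omega, h.2, h.1⟩

theorem weightedProd_eq_zero_of_eq {k : ℕ} (hk : k ≤ n + 1) (h : endWeight n α β k ≠ 0) :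
    weightedProd n α β ξ (ξ k) = 0 :=
  Finset.prod_eq_zero (Finset.mem_range.2 (by omega : k < n + 2))
    (by rw [sub_self, abs_zero, Real.zero_rpow h])

/-- The condition `weightedProd ≠ 0` singles out the regular boundary points. A point ξ_j with
exponent 0 is regular: there 0^0 = 1 on one side matches 0 · log 0 = 0 on the other. -/
theorem exp_logMap_re {x : ℝ} (hx : weightedProd n α β ξ x ≠ 0) :
    Real.exp (logMap n α β ξ C x).re = Real.exp C * weightedProd n α β ξ x := by
  rw [logMap_re, Real.exp_add, Real.exp_sum]
  congr 1
  refine Finset.prod_congr rfl fun j hj => ?_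
  have hn : ‖(x : ℂ) - ξ j‖ = |x - ξ j| := by
    rw [← Complex.ofReal_sub, Complex.norm_real, Real.norm_eq_abs]
  rw [hn]
  rcases ne_of_weightedProd_ne_zero hx hj with h | h
  · simp [h]
  · rw [Real.rpow_def_of_pos (abs_pos.2 (sub_ne_zero.2 h)), mul_comm]

theorem arg_ofReal_sub (x y : ℝ) :
    Complex.arg ((x : ℂ) - y) = if x < y then Real.pi else 0 := by
  rw [← Complex.ofReal_sub]
  split_ifs with h
  · exact Complex.arg_ofReal_of_neg (by linarith)
  · exact Complex.arg_ofReal_of_nonneg (by linarith)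

/-- On the real line arg(x - ξ_j) is π when ξ_j is to the right of x and 0 otherwise. The left end
of the gap may be included because `Complex.arg 0 = 0`. -/
theorem logMap_im_of_gap (E : Equioscillates n α β ξ C) {k : ℕ} (hk : k ≤ n) {x : ℝ}
    (h0 : ξ k ≤ x) (h1 : x < ξ (k + 1)) :
    (logMap n α β ξ C x).im = ((n : ℝ) - k) * Real.pi := by
  rw [logMap_im]
  have : ∑ j ∈ Finset.range (n + 2), endWeight n α β j * Complex.arg ((x : ℂ) - ξ j) =
      (∑ j ∈ Finset.range (n + 2), endWeight n α β j * (if k < j then 1 else 0)) * Real.pi := by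
    rw [Finset.sum_mul]
    refine Finset.sum_congr rfl fun j hj => ?_
    have hj' := Finset.mem_range.1 hj
    rw [arg_ofReal_sub]
    by_cases h : k < j
    · rw [if_pos h, if_pos (h1.trans_le (E.le_of_le h (by omega)))]; ring
    · rw [if_neg h, if_neg (not_lt.2 ((E.le_of_le (not_lt.1 h) (by omega)).trans h0))]; ring
  rw [this, sum_endWeight_tail hk]; ring

theorem logMap_im_of_neg (E : Equioscillates n α β ξ C) {x : ℝ} (h : x < 0) :
    (logMap n α β ξ C x).im = (α + n) * Real.pi := by
  rw [logMap_im]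
  have : ∑ j ∈ Finset.range (n + 2), endWeight n α β j * Complex.arg ((x : ℂ) - ξ j) =
      (∑ j ∈ Finset.range (n + 2), endWeight n α β j) * Real.pi := by
    rw [Finset.sum_mul]
    refine Finset.sum_congr rfl fun j hj => ?_
    rw [arg_ofReal_sub, if_pos (h.trans_le (E.mem_Icc
      (by have := Finset.mem_range.1 hj; omega)).1)]
  rw [this, sum_endWeight]; ring

theorem logMap_im_of_one_le (E : Equioscillates n α β ξ C) {x : ℝ} (h : 1 ≤ x) :
    (logMap n α β ξ C x).im = -β * Real.pi := by
  rw [logMap_im, Finset.sum_eq_zero, add_zero]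
  intro j hj
  rw [arg_ofReal_sub, if_neg (not_lt.2 ((E.mem_Icc
      (by have := Finset.mem_range.1 hj; omega)).2.trans h)), mul_zero]

theorem logMap_re_nonpos (E : Equioscillates n α β ξ C) {x : ℝ}
    (hx : weightedProd n α β ξ x ≠ 0) (hx' : x ∈ Set.Icc (0 : ℝ) 1) :
    (logMap n α β ξ C x).re ≤ 0 := by
  rw [← Real.exp_le_one_iff, exp_logMap_re hx]
  calc Real.exp C * weightedProd n α β ξ x ≤ Real.exp C * Real.exp (-C) :=
        mul_le_mul_of_nonneg_left (E.le_exp x hx') (Real.exp_pos C).le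
    _ = 1 := by rw [← Real.exp_add, add_neg_cancel, Real.exp_zero]

/-- The regular part of the real line goes to the boundary of the comb: x < 0 to the upper edge, x ≥
1 to the lower edge, and the gap k into the cut of height n - k, since the real part is nonpositive
on [0, 1]. -/
theorem logMap_ofReal_notMem (E : Equioscillates n α β ξ C) {x : ℝ}
    (hx : weightedProd n α β ξ x ≠ 0) : logMap n α β ξ C x ∉ combDomain n α β := by
  rintro ⟨h1, h2, h3⟩
  rw [lt_div_iff₀ Real.pi_pos] at h1
  rw [div_lt_iff₀ Real.pi_pos] at h2
  rcases lt_or_ge x 0 with h | h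
  · rw [logMap_im_of_neg E h] at h2; exact lt_irrefl _ h2
  rcases le_or_gt 1 x with h' | h'
  · rw [logMap_im_of_one_le E h'] at h1; exact lt_irrefl _ h1
  obtain ⟨k, hk, hk0, hk1⟩ := E.exists_gap h h'
  refine h3 (n - k) (by omega) ⟨?_, logMap_re_nonpos E hx ⟨h, h'.le⟩⟩
  rw [logMap_im_of_gap E hk hk0 hk1, mul_div_cancel_right₀ _ Real.pi_ne_zero, Nat.cast_sub hk]

/-- The closed upper half-plane without `0` is a domain of continuity of the logarithm. -/
theorem continuousWithinAt_log_sub {x y : ℝ} (h : x ≠ y) :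
    ContinuousWithinAt (fun z : ℂ => Complex.log (z - y)) {z | 0 ≤ z.im} x := by
  rcases lt_or_gt_of_ne h with h | h
  · have h1 := Complex.continuousWithinAt_log_of_re_neg_of_im_zero (z := (x : ℂ) - y)
      (by simpa using h) (by simp)
    exact h1.comp (f := fun z : ℂ => z - y) (by fun_prop) (fun z hz => by simpa using! hz)
  · refine ContinuousAt.continuousWithinAt ?_
    refine ContinuousAt.clog (by fun_prop) (Or.inl ?_)
    simpa using h

theorem continuousWithinAt_logMap {x : ℝ} (hx : weightedProd n α β ξ x ≠ 0) :
    ContinuousWithinAt (logMap n α β ξ C) {z | 0 ≤ z.im} x := by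
  refine continuousWithinAt_const.add (tendsto_finsetSum _ fun j hj => ?_)
  rcases ne_of_weightedProd_ne_zero hx hj with h | h
  · simp only [h, Complex.ofReal_zero, zero_mul]; exact tendsto_const_nhds
  · exact (continuousWithinAt_log_sub h).tendsto.const_mul _

theorem upperHalf_subset : upperHalf ⊆ {z : ℂ | 0 ≤ z.im} :=
  fun z hz => le_of_lt (show 0 < z.im from hz)

theorem tendsto_logMap {x : ℝ} (hx : weightedProd n α β ξ x ≠ 0) :
    Tendsto (logMap n α β ξ C) (𝓝[upperHalf] (x : ℂ)) (𝓝 (logMap n α β ξ C x)) :=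
  (continuousWithinAt_logMap hx).mono upperHalf_subset

theorem isBoundedUnder_log_norm (x y : ℝ) :
    ∃ B, ∀ᶠ z : ℂ in 𝓝[upperHalf] (x : ℂ), Real.log ‖z - y‖ ≤ B := by
  refine ⟨‖(x : ℂ) - y‖ + 1, ?_⟩
  have h : Tendsto (fun z : ℂ => ‖z - y‖) (𝓝[upperHalf] (x : ℂ)) (𝓝 ‖(x : ℂ) - y‖) :=
    ((continuous_id.sub continuous_const).norm.tendsto (x : ℂ)).mono_left nhdsWithin_le_nhds
  filter_upwards [h.eventually_le_const (lt_add_one _)] with z hz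
  exact (Real.log_le_self (norm_nonneg _)).trans hz

theorem tendsto_sub_nhdsWithin_upperHalf (y : ℝ) :
    Tendsto (fun z : ℂ => Real.log ‖z - y‖) (𝓝[upperHalf] (y : ℂ)) atBot := by
  refine Real.tendsto_log_nhdsGT_zero.comp ?_
  refine tendsto_nhdsWithin_iff.2 ⟨?_, ?_⟩
  · have h := ((continuous_id.sub (continuous_const (y := (y : ℂ)))).norm.tendsto (y : ℂ)).mono_left
      (nhdsWithin_le_nhds (s := upperHalf))
    simpa using h
  · filter_upwards [self_mem_nhdsWithin] with z hz
    refine norm_pos_iff.2 fun h => ?_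
    have hz' : 0 < (z - y).im := by simpa [upperHalf] using hz
    rw [h] at hz'
    simp at hz'

/-- The real part tends to `-∞` at the singular points. -/
theorem tendsto_logMap_re_atBot (hα : 0 ≤ α) (hβ : 0 ≤ β) {k : ℕ} (hk : k ≤ n + 1)
    (hw : endWeight n α β k ≠ 0) :
    Tendsto (fun z => (logMap n α β ξ C z).re) (𝓝[upperHalf] (ξ k : ℂ)) atBot := by
  have hk' : k ∈ Finset.range (n + 2) := Finset.mem_range.2 (by omega)
  choose B hB using fun j => isBoundedUnder_log_norm (ξ k) (ξ j)
  have hw' : 0 < endWeight n α β k := lt_of_le_of_ne (endWeight_nonneg hα hβ k) hw.symm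
  have h1 : Tendsto (fun z : ℂ => C + ∑ j ∈ (Finset.range (n + 2)).erase k,
      endWeight n α β j * B j + endWeight n α β k * Real.log ‖z - ξ k‖)
      (𝓝[upperHalf] (ξ k : ℂ)) atBot :=
    tendsto_atBot_add_const_left _ _
      ((tendsto_sub_nhdsWithin_upperHalf (ξ k)).const_mul_atBot hw')
  refine tendsto_atBot_mono' _ ?_ h1
  have h2 : ∀ᶠ z : ℂ in 𝓝[upperHalf] (ξ k : ℂ), ∀ j ∈ (Finset.range (n + 2)).erase k,
      Real.log ‖z - ξ j‖ ≤ B j := (Finset.eventually_all _).2 fun j _ => hB j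
  filter_upwards [h2] with z hz
  rw [logMap_re, ← Finset.add_sum_erase _ _ hk']
  have := Finset.sum_le_sum fun j hj =>
    mul_le_mul_of_nonneg_left (hz j hj) (endWeight_nonneg (n := n) hα hβ j)
  linarith

theorem tendsto_logMap_re_atTop (hα : 0 ≤ α) (hβ : 0 ≤ β) (hpos : 0 < α + β + n) :
    Tendsto (fun z => (logMap n α β ξ C z).re) (Bornology.cobounded ℂ) atTop := by
  have hlog : ∀ y : ℝ, Tendsto (fun z : ℂ => Real.log ‖z - y‖) (Bornology.cobounded ℂ) atTop := by
    intro y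
    refine Real.tendsto_log_atTop.comp ?_
    refine tendsto_atTop_mono (fun z => norm_sub_norm_le z y) ?_
    exact tendsto_atTop_add_const_right _ _ tendsto_norm_cobounded_atTop
  obtain ⟨i, hi, hi0⟩ := exists_endWeight_pos hpos
  have h1 : Tendsto (fun z : ℂ => C + endWeight n α β i * Real.log ‖z - ξ i‖)
      (Bornology.cobounded ℂ) atTop :=
    tendsto_atTop_add_const_left _ _ ((hlog (ξ i)).const_mul_atTop hi0)
  refine tendsto_atTop_mono' _ ?_ h1
  have h2 : ∀ᶠ z : ℂ in Bornology.cobounded ℂ, ∀ j ∈ Finset.range (n + 2),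
      0 ≤ Real.log ‖z - ξ j‖ :=
    (Finset.eventually_all _).2 fun j _ => (hlog (ξ j)).eventually_ge_atTop 0
  filter_upwards [h2] with z hz
  rw [logMap_re]
  have := Finset.single_le_sum (f := fun j => endWeight n α β j * Real.log ‖z - ξ j‖)
    (fun j hj => mul_nonneg (endWeight_nonneg (n := n) hα hβ j) (hz j hj)) hi
  linarith

theorem tendsto_vertical (x : ℝ) :
    Tendsto (fun t : ℝ => (x : ℂ) + t * Complex.I) (𝓝[>] 0) (𝓝[upperHalf] (x : ℂ)) := by
  refine tendsto_nhdsWithin_iff.2 ⟨?_, ?_⟩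
  · have h : Continuous (fun t : ℝ => (x : ℂ) + t * Complex.I) := by fun_prop
    have := h.tendsto 0
    simp only [Complex.ofReal_zero, zero_mul, add_zero] at this
    exact this.mono_left nhdsWithin_le_nhds
  · filter_upwards [self_mem_nhdsWithin] with t ht
    simpa [upperHalf] using ht

instance neBot_nhdsWithin_upperHalf (x : ℝ) : NeBot (𝓝[upperHalf] (x : ℂ)) :=
  (tendsto_vertical x).neBot

/-! ### The image of the sum of logarithms -/

theorem endWeight_ne_zero_or (hpos : 0 < α + β + n) {k : ℕ}
    (hk : k ≤ n) : endWeight n α β k ≠ 0 ∨ endWeight n α β (k + 1) ≠ 0 := by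
  rcases Nat.eq_zero_or_pos n with hn | hn
  · subst hn
    obtain rfl : k = 0 := by omega
    rw [endWeight_zero, endWeight_last]
    by_contra! h
    simp [h.1, h.2] at hpos
  · rcases Nat.eq_zero_or_pos k with h0 | h0
    · right; rw [endWeight_of_mem _ _ (by omega) (by omega)]; norm_num
    · left; rw [endWeight_of_mem _ _ h0 hk]; norm_num

/-- The sum of logarithms takes every value of a cut on the corresponding interval. -/
theorem exists_logMap_ofReal_eq (E : Equioscillates n α β ξ C) (hα : 0 ≤ α) (hβ : 0 ≤ β)
    (hpos : 0 < α + β + n) {j : ℕ} (hj : j ≤ n) {p : ℂ} (hp : p.im / Real.pi = j)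
    (hp' : p.re ≤ 0) : ∃ x : ℝ, weightedProd n α β ξ x ≠ 0 ∧ logMap n α β ξ C x = p := by
  obtain ⟨k, hk⟩ : ∃ k, k = n - j := ⟨_, rfl⟩
  have hkn : k ≤ n := by omega
  obtain ⟨y, hy, hyV⟩ := E.exists_eq k hkn
  -- At least one end of the gap is a zero of the product, so by the intermediate value theorem the
  -- product takes all values from 0 to e^{-C} on the gap.
  obtain ⟨e, he, heV⟩ : ∃ e ∈ Set.Icc (ξ k) (ξ (k + 1)), weightedProd n α β ξ e = 0 := by
    rcases endWeight_ne_zero_or hpos hkn with h | h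
    · exact ⟨ξ k, ⟨le_rfl, (E.lt k hkn).le⟩, weightedProd_eq_zero_of_eq (by omega) h⟩
    · exact ⟨ξ (k + 1), ⟨(E.lt k hkn).le, le_rfl⟩, weightedProd_eq_zero_of_eq (by omega) h⟩
  have hmem : Real.exp (p.re - C) ∈
      Set.uIcc (weightedProd n α β ξ e) (weightedProd n α β ξ y) := by
    rw [heV, hyV, Set.uIcc_of_le (Real.exp_pos _).le]
    exact ⟨(Real.exp_pos _).le, Real.exp_le_exp.2 (by linarith)⟩
  obtain ⟨x, hx, hxV⟩ := intermediate_value_uIcc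
    (weightedProd_continuous hα hβ ξ).continuousOn hmem
  have hx' : x ∈ Set.Icc (ξ k) (ξ (k + 1)) := Set.uIcc_subset_Icc he hy hx
  have hV : weightedProd n α β ξ x ≠ 0 := by rw [hxV]; exact (Real.exp_pos _).ne'
  refine ⟨x, hV, Complex.ext ?_ ?_⟩
  · have := exp_logMap_re (C := C) hV
    rw [hxV, ← Real.exp_add] at this
    have := Real.exp_injective this
    rw [this]; ring
  · have hpi : p.im = j * Real.pi := by
      rw [← hp, div_mul_cancel₀ _ Real.pi_ne_zero]
    have hkj : (n : ℝ) - k = j := by rw [hk, Nat.cast_sub hj]; ring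
    rcases hx'.2.lt_or_eq with h | h
    · rw [logMap_im_of_gap E hkn hx'.1 h, hpi, hkj]
    -- The right end of the gap is a regular point only if k = n and β = 0; then x = 1 and both
    -- formulas for the imaginary part give 0.
    · rcases ne_of_weightedProd_ne_zero hV (Finset.mem_range.2 (by omega : k + 1 < n + 2))
        with h' | h'
      · rcases hkn.lt_or_eq with h2 | h2
        · rw [endWeight_of_mem _ _ (by omega) (by omega)] at h'
          norm_num at h'
        · rw [h2, endWeight_last] at h'
          rw [logMap_im_of_one_le E (by rw [h, h2, E.last]), hpi, ← hkj, h', h2]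
          ring
      · exact absurd h h'

/-- By injectivity and openness, a boundary value is not taken inside. -/
theorem logMap_ne_of_tendsto (hα : 0 ≤ α) (hβ : 0 ≤ β) (hpos : 0 < α + β + n) {x : ℝ} {p z₀ : ℂ}
    (hz₀ : z₀ ∈ upperHalf) (hx : Tendsto (logMap n α β ξ C) (𝓝[upperHalf] (x : ℂ)) (𝓝 p)) :
    logMap n α β ξ C z₀ ≠ p := by
  rintro rfl
  have hne : (x : ℂ) ≠ z₀ := by
    rintro rfl
    simp [upperHalf] at hz₀
  obtain ⟨A, B, hA, hB, hxA, hzB, hAB⟩ := t2_separation hne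
  have hBn : B ∩ upperHalf ∈ 𝓝 z₀ :=
    inter_mem (hB.mem_nhds hzB) (isOpen_upperHalf.mem_nhds hz₀)
  have h1 : logMap n α β ξ C '' (B ∩ upperHalf) ∈ 𝓝 (logMap n α β ξ C z₀) := by
    rw [← map_nhds_logMap hα hβ hpos hz₀]
    exact image_mem_map hBn
  have h2 : logMap n α β ξ C ⁻¹' (logMap n α β ξ C '' (B ∩ upperHalf)) ∈ 𝓝[upperHalf] (x : ℂ) :=
    hx h1
  have h3 : A ∈ 𝓝[upperHalf] (x : ℂ) := mem_nhdsWithin_of_mem_nhds (hA.mem_nhds hxA)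
  obtain ⟨z, ⟨⟨z', hz', hzz⟩, hzA⟩, hzH⟩ :=
    Filter.nonempty_of_mem (inter_mem (inter_mem h2 h3) self_mem_nhdsWithin)
  have := logMap_injOn hα hβ hpos hz'.2 hzH hzz
  subst this
  exact Set.disjoint_left.1 hAB hzA hz'.1

/-- Every point of a cut is already a boundary value at a regular real point, and by
`logMap_ne_of_tendsto` a boundary value is not taken inside. -/
theorem mapsTo_logMap (E : Equioscillates n α β ξ C) (hα : 0 ≤ α) (hβ : 0 ≤ β)
    (hpos : 0 < α + β + n) :
    Set.MapsTo (logMap n α β ξ C) upperHalf (combDomain n α β) := by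
  intro z hz
  refine ⟨(logMap_im_mem hα hβ hpos hz).1, (logMap_im_mem hα hβ hpos hz).2, ?_⟩
  rintro j hj ⟨h1, h2⟩
  obtain ⟨x, hx, hxp⟩ := exists_logMap_ofReal_eq E hα hβ hpos hj h1 h2
  have := tendsto_logMap (C := C) hx
  rw [hxp] at this
  exact logMap_ne_of_tendsto hα hβ hpos hz this rfl

/-- Horizontal translation to the right never meets a cut and ends in the convex half-strip Re > 0.
-/
theorem isPreconnected_combDomain (n : ℕ) (α β : ℝ) : IsPreconnected (combDomain n α β) := by
  have hright : ∀ p ∈ combDomain n α β, ∀ t : ℝ, 0 ≤ t → p + t ∈ combDomain n α β := by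
    rintro p ⟨h1, h2, h3⟩ t ht
    refine ⟨by simpa using h1, by simpa using h2, fun j hj h => h3 j hj ?_⟩
    simp only [Complex.add_im, Complex.ofReal_im, add_zero, Complex.add_re, Complex.ofReal_re] at h
    exact ⟨h.1, by linarith [h.2]⟩
  set S : Set ℂ := {w | -β * Real.pi < w.im} ∩ {w | w.im < (α + n) * Real.pi} ∩ {w | 0 < w.re}
    with hS
  have hSc : Convex ℝ S := ((convex_halfSpace_im_gt _).inter (convex_halfSpace_im_lt _)).inter
    (convex_halfSpace_re_gt _)
  have hSsub : S ⊆ combDomain n α β := by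
    rintro p ⟨⟨h1, h2⟩, h3⟩
    simp only [Set.mem_ofPred_eq] at h1 h2 h3
    refine ⟨(lt_div_iff₀ Real.pi_pos).2 h1, (div_lt_iff₀ Real.pi_pos).2 h2, fun j _ h => ?_⟩
    linarith [h.2]
  have hto : ∀ p ∈ combDomain n α β, ∃ q ∈ S, JoinedIn (combDomain n α β) p q := by
    intro p hp
    have hq : p + ((|p.re| + 1 : ℝ) : ℂ) ∈ S := by
      refine ⟨⟨?_, ?_⟩, ?_⟩
      · have := (lt_div_iff₀ Real.pi_pos).1 hp.1
        simpa using! this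
      · have := (div_lt_iff₀ Real.pi_pos).1 hp.2.1
        simpa using! this
      · have := neg_abs_le p.re
        simp only [Set.mem_ofPred_eq, Complex.add_re, Complex.ofReal_re]
        linarith
    refine ⟨_, hq, JoinedIn.of_segment_subset ?_⟩
    rintro q ⟨a, b, ha, hb, hab, rfl⟩
    have h1 : a • p + b • (p + ((|p.re| + 1 : ℝ) : ℂ)) = p + ((b * (|p.re| + 1) : ℝ) : ℂ) := by
      have : (a : ℂ) + b = 1 := by exact_mod_cast hab
      simp only [Complex.real_smul]
      push_cast
      linear_combination p * this
    rw [h1]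
    exact hright p hp _ (by positivity)
  rcases (combDomain n α β).eq_empty_or_nonempty with h | hne
  · rw [h]; exact isPreconnected_empty
  refine IsPathConnected.isConnected ?_ |>.isPreconnected
  refine isPathConnected_iff.2 ⟨hne, fun p hp q hq => ?_⟩
  obtain ⟨p', hp', hpp⟩ := hto p hp
  obtain ⟨q', hq', hqq⟩ := hto q hq
  have h := (hSc.isPathConnected ⟨p', hp'⟩).joinedIn p' hp' q' hq'
  exact (hpp.trans (h.mono hSsub)).trans hqq.symm

/-- The image is open, and it is relatively closed in the connected comb domain: if values converge
to p, their preimages stay bounded because Re w → +∞ at ∞. An accumulation point on the real line is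
impossible: at a singular point Re w → -∞, at a regular one p would lie outside the comb domain. -/
theorem surjOn_logMap (E : Equioscillates n α β ξ C) (hα : 0 ≤ α) (hβ : 0 ≤ β)
    (hpos : 0 < α + β + n) :
    Set.SurjOn (logMap n α β ξ C) upperHalf (combDomain n α β) := by
  set w := logMap n α β ξ C with hw
  have hopen : IsOpen (w '' upperHalf) := by
    rw [isOpen_iff_mem_nhds]
    rintro _ ⟨z, hz, rfl⟩
    rw [hw, ← map_nhds_logMap hα hβ hpos hz]
    exact image_mem_map (isOpen_upperHalf.mem_nhds hz)
  refine (isPreconnected_combDomain n α β).subset_of_closure_inter_subset hopen ?_ ?_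
  · have hI : Complex.I ∈ upperHalf := by simp [upperHalf]
    exact ⟨w Complex.I, mapsTo_logMap E hα hβ hpos hI, ⟨_, hI, rfl⟩⟩
  · rintro p ⟨hpc, hp⟩
    have : NeBot (𝓝[w '' upperHalf] p) := mem_closure_iff_nhdsWithin_neBot.1 hpc
    have hF : NeBot (comap w (𝓝[w '' upperHalf] p) ⊓ 𝓟 upperHalf) :=
      comap_inf_principal_neBot_of_image_mem this self_mem_nhdsWithin
    set U := Ultrafilter.of (comap w (𝓝[w '' upperHalf] p) ⊓ 𝓟 upperHalf)
    have hU := Ultrafilter.of_le (comap w (𝓝[w '' upperHalf] p) ⊓ 𝓟 upperHalf)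
    have hUw : Tendsto w U (𝓝 p) :=
      (tendsto_iff_comap.2 (hU.trans inf_le_left)).mono_right nhdsWithin_le_nhds
    have hUH : ∀ᶠ z in (U : Filter ℂ), z ∈ upperHalf := hU (mem_inf_of_right (mem_principal_self _))
    have hUre : Tendsto (fun z => (w z).re) U (𝓝 p.re) :=
      (Complex.continuous_re.tendsto p).comp hUw
    obtain ⟨R, hR⟩ : ∃ R : ℝ, ∀ᶠ z in (U : Filter ℂ), z ∈ Metric.closedBall (0 : ℂ) R := by
      have h1 := (tendsto_logMap_re_atTop (ξ := ξ) (C := C) hα hβ hpos).eventually_gt_atTop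
        (p.re + 1)
      obtain ⟨R, -, hR⟩ := (Metric.hasBasis_cobounded_compl_closedBall (0 : ℂ)).eventually_iff.1 h1
      refine ⟨R, ?_⟩
      filter_upwards [hUre.eventually_lt_const (lt_add_one p.re)] with z hz
      by_contra hzR
      exact lt_asymm hz (hR hzR)
    obtain ⟨x, -, hx⟩ := (isCompact_closedBall (0 : ℂ) R).ultrafilter_le_nhds U
      (le_principal_iff.2 hR)
    have hx0 : 0 ≤ x.im := by
      have h1 : Tendsto (fun z : ℂ => z.im) U (𝓝 x.im) :=
        (Complex.continuous_im.tendsto x).mono_left hx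
      exact ge_of_tendsto h1 (hUH.mono fun z hz => le_of_lt (show 0 < z.im from hz))
    rcases hx0.lt_or_eq with h | h
    · have h1 : Tendsto w U (𝓝 (w x)) :=
        ((hasDerivAt_logMap (z := x) h).continuousAt.tendsto).mono_left hx
      exact ⟨x, h, tendsto_nhds_unique h1 hUw⟩
    · obtain ⟨y, rfl⟩ : ∃ y : ℝ, x = y := ⟨x.re, by
        apply Complex.ext <;> simp [← h]⟩
      have hUy : (U : Filter ℂ) ≤ 𝓝[upperHalf] (y : ℂ) := le_inf hx (le_principal_iff.2 hUH)
      by_cases hV : weightedProd n α β ξ y = 0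
      · obtain ⟨k, hk, hk0, rfl⟩ := exists_of_weightedProd_eq_zero hV
        have h1 := (tendsto_logMap_re_atBot (C := C) hα hβ hk hk0).mono_left hUy
        exact absurd hUre (not_tendsto_nhds_of_tendsto_atBot h1 _)
      · have h1 := (tendsto_logMap (C := C) hV).mono_left hUy
        have h2 := tendsto_nhds_unique h1 hUw
        exact absurd (h2 ▸ hp) (logMap_ofReal_notMem E hV)

/-! ### Behaviour at the ends -/

theorem tendsto_arg_vertical (x y : ℝ) :
    Tendsto (fun t : ℝ => Complex.arg ((x : ℂ) + t * Complex.I - y)) (𝓝[>] 0)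
      (𝓝 (if x < y then Real.pi else if x = y then Real.pi / 2 else 0)) := by
  rcases lt_trichotomy x y with h | h | h
  · rw [if_pos h]
    have h1 : Tendsto (fun z : ℂ => Complex.arg (z - y)) (𝓝[upperHalf] (x : ℂ))
        (𝓝 (Complex.log ((x : ℂ) - y)).im) := by
      simpa only [Function.comp_def, Complex.log_im] using (Complex.continuous_im.tendsto _).comp
        ((continuousWithinAt_log_sub h.ne).mono upperHalf_subset).tendsto
    rw [Complex.log_im, arg_ofReal_sub, if_pos h] at h1
    exact h1.comp (tendsto_vertical x)
  · subst h
    rw [if_neg (lt_irrefl _), if_pos rfl]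
    refine tendsto_const_nhds.congr' ?_
    filter_upwards [self_mem_nhdsWithin] with t ht
    rw [add_sub_cancel_left, Complex.arg_real_mul _ ht, Complex.arg_I]
  · rw [if_neg h.not_gt, if_neg h.ne']
    have h1 : Tendsto (fun z : ℂ => Complex.arg (z - y)) (𝓝[upperHalf] (x : ℂ))
        (𝓝 (Complex.log ((x : ℂ) - y)).im) := by
      simpa only [Function.comp_def, Complex.log_im] using (Complex.continuous_im.tendsto _).comp
        ((continuousWithinAt_log_sub h.ne').mono upperHalf_subset).tendsto
    rw [Complex.log_im, arg_ofReal_sub, if_neg h.not_gt] at h1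
    exact h1.comp (tendsto_vertical x)

/-- Seen vertically, ξ_k contributes the angle π/2. The limit is the middle height of a half-strip
when the exponent is positive, which identifies the infinite point belonging to ξ_k. -/
theorem tendsto_logMap_im_vertical (E : Equioscillates n α β ξ C) {k : ℕ} (hk : k ≤ n + 1) :
    Tendsto (fun t : ℝ => (logMap n α β ξ C ((ξ k : ℂ) + t * Complex.I)).im / Real.pi) (𝓝[>] 0)
      (𝓝 (if k = n + 1 then -β / 2 else (n : ℝ) - k + endWeight n α β k / 2)) := by
  have h1 : Tendsto (fun t : ℝ => (logMap n α β ξ C ((ξ k : ℂ) + t * Complex.I)).im / Real.pi)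
      (𝓝[>] 0) (𝓝 ((-β * Real.pi + ∑ j ∈ Finset.range (n + 2), endWeight n α β j *
        (if ξ k < ξ j then Real.pi else if ξ k = ξ j then Real.pi / 2 else 0)) / Real.pi)) := by
    simp only [logMap_im]
    exact (tendsto_const_nhds.add (tendsto_finsetSum _ fun j _ =>
      (tendsto_arg_vertical (ξ k) (ξ j)).const_mul _)).div_const _
  convert h1 using 2
  have h2 : ∑ j ∈ Finset.range (n + 2), endWeight n α β j *
        (if ξ k < ξ j then Real.pi else if ξ k = ξ j then Real.pi / 2 else 0) =
      (∑ j ∈ Finset.range (n + 2), endWeight n α β j * (if k < j then 1 else 0)) * Real.pi +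
      endWeight n α β k * (Real.pi / 2) := by
    have h3 : endWeight n α β k * (Real.pi / 2) =
        ∑ j ∈ Finset.range (n + 2), if k = j then endWeight n α β j * (Real.pi / 2) else 0 := by
      rw [Finset.sum_ite_eq, if_pos (Finset.mem_range.2 (by omega))]
    rw [h3, Finset.sum_mul, ← Finset.sum_add_distrib]
    refine Finset.sum_congr rfl fun j hj => ?_
    have hj' := Finset.mem_range.1 hj
    rcases lt_trichotomy k j with h | h | h
    · rw [if_pos (E.lt_of_lt h (by omega)), if_pos h, if_neg h.ne]; ring
    · subst h; simp
    · have h4 := E.lt_of_lt h hk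
      rw [if_neg h4.not_gt, if_neg h4.ne', if_neg h.not_gt, if_neg h.ne']; ring
  rw [h2]
  have hpi := Real.pi_ne_zero
  split_ifs with h
  · subst h
    rw [Finset.sum_eq_zero, endWeight_last]
    · field_simp; ring
    · intro j hj
      rw [if_neg (by have := Finset.mem_range.1 hj; omega), mul_zero]
  · rw [sum_endWeight_tail (by omega)]
    field_simp
    ring

/-- On a small half-disc Re f ≤ 0, so the height avoids a and b there. The half-disc is connected
and the vertical approach has heights in (a, b), so all heights stay in (a, b). -/
theorem tendsto_leftEnd_of_avoid {f : ℂ → ℂ} (hf : ContinuousOn f upperHalf) {x a b c : ℝ}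
    (hre : Tendsto (fun z => (f z).re) (𝓝[upperHalf] (x : ℂ)) atBot)
    (havoid : ∀ z ∈ upperHalf, (f z).re ≤ 0 →
      (f z).im / Real.pi ≠ a ∧ (f z).im / Real.pi ≠ b)
    (hc : c ∈ Set.Ioo a b)
    (hvert : Tendsto (fun t : ℝ => (f ((x : ℂ) + t * Complex.I)).im / Real.pi) (𝓝[>] 0) (𝓝 c)) :
    Tendsto f (𝓝[upperHalf] (x : ℂ)) (leftEnd a b) := by
  refine tendsto_inf.2 ⟨tendsto_comap_iff.2 hre, tendsto_principal.2 ?_⟩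
  obtain ⟨r, hr, hr'⟩ := Metric.mem_nhdsWithin_iff.1 (hre.eventually_le_atBot 0)
  set S := Metric.ball (x : ℂ) r ∩ upperHalf with hS
  have hSn : S ∈ 𝓝[upperHalf] (x : ℂ) :=
    inter_mem (mem_nhdsWithin_of_mem_nhds (Metric.ball_mem_nhds _ hr)) self_mem_nhdsWithin
  have hSc : IsPreconnected S := ((convex_ball _ _).inter convex_upperHalf).isPreconnected
  set g : ℂ → ℝ := fun z => (f z).im / Real.pi with hg
  have hgc : ContinuousOn g S :=
    ((Complex.continuous_im.comp_continuousOn hf).div_const _).mono Set.inter_subset_right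
  have hgS := (hSc.image g hgc).ordConnected
  obtain ⟨t, ht, htS⟩ := ((hvert.eventually (Ioo_mem_nhds hc.1 hc.2)).and
    ((tendsto_vertical x).eventually hSn)).exists
  have hmem : g ((x : ℂ) + t * Complex.I) ∈ g '' S := ⟨_, htS, rfl⟩
  filter_upwards [hSn] with z hz
  constructor
  · by_contra! h
    obtain ⟨y, hy, hya⟩ := hgS.out ⟨z, hz, rfl⟩ hmem ⟨h, ht.1.le⟩
    exact (havoid y hy.2 (hr' hy)).1 hya
  · by_contra! h
    obtain ⟨y, hy, hyb⟩ := hgS.out hmem ⟨z, hz, rfl⟩ ⟨ht.2.le, h⟩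
    exact (havoid y hy.2 (hr' hy)).2 hyb

theorem isEndPreimages_logMap (E : Equioscillates n α β ξ C) (hα : 0 ≤ α) (hβ : 0 ≤ β)
    (hpos : 0 < α + β + n) : IsEndPreimages n (logMap n α β ξ C) ξ := by
  intro j h1 h2
  have hw : endWeight n α β j = 1 := endWeight_of_mem _ _ h1 h2
  have hv := tendsto_logMap_im_vertical E (k := j) (by omega)
  rw [if_neg (by omega), hw] at hv
  refine tendsto_leftEnd_of_avoid differentiableOn_logMap.continuousOn
    (tendsto_logMap_re_atBot hα hβ (by omega) (by rw [hw]; norm_num)) ?_ ?_ hv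
  · intro z hz hzr
    have hz' := (mapsTo_logMap E hα hβ hpos hz).2.2
    constructor
    · intro h
      exact hz' (n - j) (by omega) ⟨by rw [h, Nat.cast_sub h2], hzr⟩
    · intro h
      exact hz' (n - j + 1) (by omega) ⟨by rw [h]; push_cast [Nat.cast_sub h2]; ring, hzr⟩
  · constructor <;> linarith

/-! ### Finite ends: the case of a vanishing exponent α or β -/

theorem weightedProd_lt_of_lt_left (E : Equioscillates n α β ξ C) (hα : α = 0) (hβ : 0 ≤ β)
    (hpos : 0 < α + β + n) {x y : ℝ} (hxy : x < y) (hy : y ≤ ξ 1) :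
    weightedProd n α β ξ y < weightedProd n α β ξ x := by
  have hw0 : endWeight n α β 0 = 0 := by rw [endWeight_zero, hα]
  have hge : ∀ j ∈ Finset.range (n + 2), j ≠ 0 → ξ 1 ≤ ξ j := fun j hj h0 =>
    E.le_of_le (by omega) (by have := Finset.mem_range.1 hj; omega)
  have hx0 : 0 < weightedProd n α β ξ x := by
    refine Finset.prod_pos fun j hj => ?_
    rcases eq_or_ne j 0 with rfl | h
    · simp [hw0]
    · exact Real.rpow_pos_of_pos (abs_pos.2 (by have := hge j hj h; linarith)) _
  rcases eq_or_ne (weightedProd n α β ξ y) 0 with h0 | h0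
  · rw [h0]; exact hx0
  obtain ⟨i, hi, hi0⟩ := exists_endWeight_pos hpos
  have hi' : i ≠ 0 := by rintro rfl; rw [hw0] at hi0; exact lt_irrefl _ hi0
  have habs : ∀ j ∈ Finset.range (n + 2), j ≠ 0 → |y - ξ j| < |x - ξ j| := by
    intro j hj h
    have := hge j hj h
    rw [abs_of_nonpos (by linarith), abs_of_nonpos (by linarith)]
    linarith
  refine Finset.prod_lt_prod (fun j hj => ?_) (fun j hj => ?_) ⟨i, hi, ?_⟩
  · exact lt_of_le_of_ne (Real.rpow_nonneg (abs_nonneg _) _)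
      fun h => h0 (Finset.prod_eq_zero hj h.symm)
  · rcases eq_or_ne j 0 with rfl | h
    · simp [hw0]
    · exact Real.rpow_le_rpow (abs_nonneg _) (habs j hj h).le
        (endWeight_nonneg hα.ge hβ j)
  · exact Real.rpow_lt_rpow (abs_nonneg _) (habs i hi hi') hi0

theorem weightedProd_lt_of_lt_right (E : Equioscillates n α β ξ C) (hα : 0 ≤ α) (hβ : β = 0)
    (hpos : 0 < α + β + n) {x y : ℝ} (hxy : x < y) (hx : ξ n ≤ x) :
    weightedProd n α β ξ x < weightedProd n α β ξ y := by
  have hw0 : endWeight n α β (n + 1) = 0 := by rw [endWeight_last, hβ]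
  have hge : ∀ j ∈ Finset.range (n + 2), j ≠ n + 1 → ξ j ≤ ξ n := fun j hj h0 =>
    E.le_of_le (by have := Finset.mem_range.1 hj; omega) (by omega)
  have hy0 : 0 < weightedProd n α β ξ y := by
    refine Finset.prod_pos fun j hj => ?_
    rcases eq_or_ne j (n + 1) with rfl | h
    · simp [hw0]
    · exact Real.rpow_pos_of_pos (abs_pos.2 (by have := hge j hj h; linarith)) _
  rcases eq_or_ne (weightedProd n α β ξ x) 0 with h0 | h0
  · rw [h0]; exact hy0
  obtain ⟨i, hi, hi0⟩ := exists_endWeight_pos hpos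
  have hi' : i ≠ n + 1 := by rintro rfl; rw [hw0] at hi0; exact lt_irrefl _ hi0
  have habs : ∀ j ∈ Finset.range (n + 2), j ≠ n + 1 → |x - ξ j| < |y - ξ j| := by
    intro j hj h
    have := hge j hj h
    rw [abs_of_nonneg (by linarith), abs_of_nonneg (by linarith)]
    linarith
  refine Finset.prod_lt_prod (fun j hj => ?_) (fun j hj => ?_) ⟨i, hi, ?_⟩
  · exact lt_of_le_of_ne (Real.rpow_nonneg (abs_nonneg _) _)
      fun h => h0 (Finset.prod_eq_zero hj h.symm)
  · rcases eq_or_ne j (n + 1) with rfl | h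
    · simp [hw0]
    · exact Real.rpow_le_rpow (abs_nonneg _) (habs j hj h).le
        (endWeight_nonneg hα hβ.ge j)
  · exact Real.rpow_lt_rpow (abs_nonneg _) (habs i hi hi') hi0

/-- Without a factor at 0 the product decreases strictly up to ξ_1, so its maximum on the first gap
sits at 0. Hence 0 goes to the tip of the uppermost cut. -/
theorem weightedProd_zero (E : Equioscillates n α β ξ C) (hα : α = 0) (hβ : 0 ≤ β)
    (hpos : 0 < α + β + n) : weightedProd n α β ξ 0 = Real.exp (-C) := by
  obtain ⟨x, hx, hxV⟩ := E.exists_eq 0 (by omega)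
  rw [E.zero] at hx
  rcases hx.1.eq_or_lt with h | h
  · rw [h, hxV]
  · have h1 := weightedProd_lt_of_lt_left E hα hβ hpos h hx.2
    have h2 := E.le_exp 0 (by simp)
    linarith

theorem weightedProd_one (E : Equioscillates n α β ξ C) (hα : 0 ≤ α) (hβ : β = 0)
    (hpos : 0 < α + β + n) : weightedProd n α β ξ 1 = Real.exp (-C) := by
  obtain ⟨x, hx, hxV⟩ := E.exists_eq n le_rfl
  rw [E.last] at hx
  rcases hx.2.eq_or_lt with h | h
  · rw [← h, hxV]
  · have h1 := weightedProd_lt_of_lt_right E hα hβ hpos h hx.1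
    have h2 := E.le_exp 1 (by simp)
    linarith

theorem logMap_re_eq_zero_iff {x : ℝ} (hx : weightedProd n α β ξ x ≠ 0) :
    (logMap n α β ξ C x).re = 0 ↔ weightedProd n α β ξ x = Real.exp (-C) := by
  rw [← Real.exp_eq_one_iff, exp_logMap_re hx, Real.exp_neg, mul_comm]
  exact mul_eq_one_iff_eq_inv₀ (Real.exp_pos C).ne'

theorem logMap_zero (E : Equioscillates n α β ξ C) (hα : α = 0) (hβ : 0 ≤ β)
    (hpos : 0 < α + β + n) : logMap n α β ξ C (0 : ℝ) = (n : ℂ) * (Real.pi : ℂ) * Complex.I := by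
  have hV := weightedProd_zero E hα hβ hpos
  have hV0 : weightedProd n α β ξ 0 ≠ 0 := by rw [hV]; exact (Real.exp_pos _).ne'
  apply Complex.ext
  · rw [(logMap_re_eq_zero_iff hV0).2 hV]; simp
  · rw [logMap_im_of_gap E (Nat.zero_le n) E.zero.le
      (by have := E.lt 0 (Nat.zero_le n); rwa [E.zero] at this)]
    simp

theorem logMap_one (E : Equioscillates n α β ξ C) (hα : 0 ≤ α) (hβ : β = 0)
    (hpos : 0 < α + β + n) : logMap n α β ξ C (1 : ℝ) = 0 := by
  have hV := weightedProd_one E hα hβ hpos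
  have hV0 : weightedProd n α β ξ 1 ≠ 0 := by rw [hV]; exact (Real.exp_pos _).ne'
  apply Complex.ext
  · rw [(logMap_re_eq_zero_iff hV0).2 hV]; simp
  · rw [logMap_im_of_one_le E le_rfl, hβ]
    simp

theorem tendsto_logMap_endZero (E : Equioscillates n α β ξ C) (hα : 0 ≤ α) (hβ : 0 ≤ β)
    (hpos : 0 < α + β + n) :
    Tendsto (logMap n α β ξ C) (𝓝[upperHalf] 0) (endZero n α) := by
  rw [endZero]
  split_ifs with h
  · rw [← logMap_zero E h hβ hpos]
    have := tendsto_logMap (C := C) (x := 0) (n := n) (α := α) (β := β) (ξ := ξ)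
      (by rw [weightedProd_zero E h hβ hpos]; exact (Real.exp_pos _).ne')
    simpa using this
  · have hv := tendsto_logMap_im_vertical E (k := 0) (by omega)
    rw [if_neg (by omega), endWeight_zero] at hv
    have h0 : 0 < α := lt_of_le_of_ne hα (Ne.symm h)
    have := tendsto_leftEnd_of_avoid (a := n) (b := n + α) differentiableOn_logMap.continuousOn
      (tendsto_logMap_re_atBot hα hβ (by omega) (by rw [endWeight_zero]; exact h)) ?_ ?_ hv
    · rw [E.zero] at this; simpa using this
    · intro z hz hzr
      have hz' := mapsTo_logMap E hα hβ hpos hz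
      refine ⟨fun h => hz'.2.2 n le_rfl ⟨h, hzr⟩, fun h => ?_⟩
      have := hz'.2.1
      rw [h] at this
      linarith
    · simp only [Nat.cast_zero]
      constructor <;> linarith

theorem tendsto_logMap_endOne (E : Equioscillates n α β ξ C) (hα : 0 ≤ α) (hβ : 0 ≤ β)
    (hpos : 0 < α + β + n) :
    Tendsto (logMap n α β ξ C) (𝓝[upperHalf] 1) (endOne β) := by
  rw [endOne]
  split_ifs with h
  · rw [← logMap_one E hα h hpos]
    have := tendsto_logMap (C := C) (x := 1) (n := n) (α := α) (β := β) (ξ := ξ)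
      (by rw [weightedProd_one E hα h hpos]; exact (Real.exp_pos _).ne')
    simpa using this
  · have hv := tendsto_logMap_im_vertical E (k := n + 1) (by omega)
    rw [if_pos rfl] at hv
    have h0 : 0 < β := lt_of_le_of_ne hβ (Ne.symm h)
    have := tendsto_leftEnd_of_avoid (a := -β) (b := 0) differentiableOn_logMap.continuousOn
      (tendsto_logMap_re_atBot hα hβ le_rfl (by rw [endWeight_last]; exact h)) ?_ ?_ hv
    · rw [E.last] at this; simpa using this
    · intro z hz hzr
      have hz' := mapsTo_logMap E hα hβ hpos hz
      refine ⟨fun h => ?_, fun h => hz'.2.2 0 (Nat.zero_le n) ⟨by simpa using h, hzr⟩⟩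
      have := hz'.1
      rw [h] at this
      exact lt_irrefl _ this
    · constructor <;> linarith

theorem isCombMap_logMap (E : Equioscillates n α β ξ C) (hα : 0 ≤ α) (hβ : 0 ≤ β)
    (hpos : 0 < α + β + n) : IsCombMap n α β (logMap n α β ξ C) where
  differentiableOn := differentiableOn_logMap
  bijOn := ⟨mapsTo_logMap E hα hβ hpos, logMap_injOn hα hβ hpos, surjOn_logMap E hα hβ hpos⟩
  map_zero := tendsto_logMap_endZero E hα hβ hpos
  map_one := tendsto_logMap_endOne E hα hβ hpos
  map_infty := (tendsto_logMap_re_atTop hα hβ hpos).mono_left inf_le_left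

/-! ### The expansion at infinity -/

theorem log_sub_isBigO (a : ℝ) :
    (fun z : ℂ => Complex.log (z - a) - Complex.log z)
      =O[Bornology.cobounded ℂ ⊓ 𝓟 upperHalf] (fun z : ℂ => z⁻¹) := by
  -- Mean value inequality for t ↦ log(z - ta) on [0, 1]: the derivative is at most |a| / (|z|/2)
  -- once |z| ≥ 2|a|.
  refine Asymptotics.IsBigO.of_bound (2 * |a|) ?_
  have h1 : ∀ᶠ z : ℂ in Bornology.cobounded ℂ ⊓ 𝓟 upperHalf, 2 * |a| + 1 ≤ ‖z‖ :=
    (tendsto_norm_cobounded_atTop.eventually_ge_atTop _).filter_mono inf_le_left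
  filter_upwards [h1, mem_inf_of_right (mem_principal_self upperHalf)] with z hz hzH
  have hz0 : 0 < ‖z‖ := by linarith [abs_nonneg a]
  have h2 : ∀ t ∈ Set.Icc (0 : ℝ) 1, HasDerivWithinAt
      (fun t : ℝ => Complex.log (z - (t * a : ℝ))) (-(a : ℂ) / (z - (t * a : ℝ)))
      (Set.Icc 0 1) t := by
    intro t _
    have h3 : HasDerivAt (fun t : ℝ => z - ((t * a : ℝ) : ℂ)) (-(a : ℂ)) t := by
      have := (((hasDerivAt_id t).mul_const a).ofReal_comp).const_sub z
      simpa using! this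
    exact (h3.clog_real (sub_ofReal_mem_slitPlane hzH (t * a))).hasDerivWithinAt
  have h4 := norm_image_sub_le_of_norm_deriv_le_segment_01' h2 (C := 2 * |a| * ‖z‖⁻¹) ?_
  · simpa [norm_inv] using h4
  · intro t ht
    rw [norm_div, norm_neg, Complex.norm_real, Real.norm_eq_abs]
    have h5 : ‖z‖ / 2 ≤ ‖z - (t * a : ℝ)‖ := by
      have := norm_sub_norm_le z ((t * a : ℝ) : ℂ)
      rw [Complex.norm_real, Real.norm_eq_abs, abs_mul, abs_of_nonneg ht.1] at this
      nlinarith [abs_nonneg a, ht.2]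
    rw [div_le_iff₀ (by linarith)]
    calc |a| = 2 * |a| * ‖z‖⁻¹ * (‖z‖ / 2) := by field_simp
      _ ≤ _ := mul_le_mul_of_nonneg_left h5 (by positivity)

theorem isCombConstant_logMap : IsCombConstant n α β (logMap n α β ξ C) C := by
  have h : ∀ z : ℂ, logMap n α β ξ C z - (((α + β + n : ℝ) : ℂ) * Complex.log z + (C : ℂ) -
      (β : ℂ) * (Real.pi : ℂ) * Complex.I) = ∑ j ∈ Finset.range (n + 2),
        (endWeight n α β j : ℂ) * (Complex.log (z - ξ j) - Complex.log z) := by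
    intro z
    simp only [mul_sub, Finset.sum_sub_distrib, ← Finset.sum_mul]
    rw [← Complex.ofReal_sum, sum_endWeight, logMap]
    ring
  simp only [IsCombConstant, h]
  exact Asymptotics.IsBigO.fun_sum fun j _ => (log_sub_isBigO (ξ j)).const_mul_left _

/-! ### Automorphisms of the upper half-plane -/

theorem nhds_le_map_nhds_of_injOn {U : Set ℂ} (hU : IsOpen U) {f : ℂ → ℂ}
    (hf : DifferentiableOn ℂ f U) (hinj : Set.InjOn f U) {z : ℂ} (hz : z ∈ U) :
    𝓝 (f z) ≤ map f (𝓝 z) := by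
  refine (hf.analyticAt (hU.mem_nhds hz)).eventually_constant_or_nhds_le_map_nhds.resolve_left ?_
  intro h
  have h1 : ∀ᶠ y in 𝓝[≠] z, (f y = f z ∧ y ∈ U) ∧ y ≠ z :=
    ((h.and (hU.mem_nhds hz)).filter_mono nhdsWithin_le_nhds).and self_mem_nhdsWithin
  obtain ⟨y, ⟨hy, hyU⟩, hne⟩ := h1.exists
  exact hne (hinj hyU hz hy)

/-- The inverse of an injective holomorphic function is holomorphic. -/
theorem differentiableOn_of_leftInvOn {U : Set ℂ} (hU : IsOpen U) {f g : ℂ → ℂ}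
    (hf : DifferentiableOn ℂ f U) (hgf : Set.LeftInvOn g f U) :
    DifferentiableOn ℂ g (f '' U) := by
  have hinj : Set.InjOn f U := hgf.injOn
  have hopen : ∀ s ⊆ U, IsOpen s → IsOpen (f '' s) := by
    intro s hs hso
    rw [isOpen_iff_mem_nhds]
    rintro _ ⟨z, hz, rfl⟩
    exact nhds_le_map_nhds_of_injOn hU hf hinj (hs hz) (image_mem_map (hso.mem_nhds hz))
  have hcont : ∀ z ∈ U, ContinuousAt g (f z) := by
    intro z hz
    have h1 : Tendsto g (map f (𝓝 z)) (𝓝 (g (f z))) := by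
      rw [hgf hz, tendsto_map'_iff]
      exact tendsto_id.congr' (by
        filter_upwards [hU.mem_nhds hz] with y hy using (hgf hy).symm)
    exact h1.mono_left (nhds_le_map_nhds_of_injOn hU hf hinj hz)
  have hder : ∀ z ∈ U, deriv f z ≠ 0 → DifferentiableAt ℂ g (f z) := by
    intro z hz h0
    refine (HasDerivAt.of_local_left_inverse (f := f) (f' := deriv f z) (hcont z hz) ?_ h0
      ?_).differentiableAt
    · rw [hgf hz]
      exact (hf.differentiableAt (hU.mem_nhds hz)).hasDerivAt
    · filter_upwards [(hopen U subset_rfl hU).mem_nhds ⟨z, hz, rfl⟩]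
      rintro _ ⟨y, hy, rfl⟩
      rw [hgf hy]
  rintro _ ⟨z, hz, rfl⟩
  have han := (hf.analyticAt (hU.mem_nhds hz)).deriv
  -- Zeros of f' are isolated, since f would otherwise be constant on a disc. The inverse is
  -- therefore holomorphic off f(z) nearby and continuous at f(z), and the singularity is removable.
  have hne : ∀ᶠ y in 𝓝[≠] z, deriv f y ≠ 0 := by
    refine han.eventually_eq_zero_or_eventually_ne_zero.resolve_left fun h => ?_
    obtain ⟨r, hr, hball⟩ := Metric.mem_nhds_iff.1 (inter_mem h (hU.mem_nhds hz))
    obtain ⟨c, hconst⟩ := Metric.isOpen_ball.exists_is_const_of_deriv_eq_zero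
      (convex_ball z r).isPreconnected (hf.mono fun y hy => (hball hy).2)
      (fun y hy => (hball hy).1)
    have hy : z + (r / 2 : ℝ) ∈ Metric.ball z r := by
      rw [mem_ball_iff_norm, add_sub_cancel_left, Complex.norm_real, Real.norm_eq_abs,
        abs_of_pos (by linarith)]
      linarith
    have h1 := hinj (hball hy).2 hz ((hconst _ hy).trans (hconst _ (Metric.mem_ball_self hr)).symm)
    rw [add_eq_left, Complex.ofReal_eq_zero] at h1
    linarith
  obtain ⟨r, hr, hball⟩ := Metric.mem_nhdsWithin_iff.1 hne
  set s := Metric.ball z r ∩ U with hs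
  have hsz : z ∈ s := ⟨Metric.mem_ball_self hr, hz⟩
  have hso : f '' s ∈ 𝓝 (f z) :=
    (hopen s Set.inter_subset_right (Metric.isOpen_ball.inter hU)).mem_nhds ⟨z, hsz, rfl⟩
  have hd : DifferentiableOn ℂ g (f '' s) := by
    refine (Complex.differentiableOn_compl_singleton_and_continuousAt_iff hso).1 ⟨?_, hcont z hz⟩
    rintro _ ⟨⟨y, hy, rfl⟩, hyz⟩
    refine (hder y hy.2 (hball ⟨hy.1, ?_⟩)).differentiableWithinAt
    rintro rfl
    exact hyz rfl
  exact (hd.differentiableAt hso).differentiableWithinAt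

theorem norm_sub_lt_norm_sub_conj {v b : ℂ} (hv : v ∈ upperHalf) (hb : b ∈ upperHalf) :
    ‖v - b‖ < ‖v - starRingEnd ℂ b‖ := by
  have hv' : 0 < v.im := hv
  have hb' : 0 < b.im := hb
  rw [← sq_lt_sq₀ (norm_nonneg _) (norm_nonneg _), ← Complex.normSq_eq_norm_sq,
    ← Complex.normSq_eq_norm_sq, Complex.normSq_apply, Complex.normSq_apply]
  simp only [Complex.sub_re, Complex.sub_im, Complex.conj_re, Complex.conj_im]
  nlinarith [mul_pos hv' hb']

theorem norm_sub_conj_sq (v b : ℂ) :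
    ‖v - starRingEnd ℂ b‖ ^ 2 = ‖v - b‖ ^ 2 + 4 * v.im * b.im := by
  rw [← Complex.normSq_eq_norm_sq, ← Complex.normSq_eq_norm_sq, Complex.normSq_apply,
    Complex.normSq_apply]
  simp only [Complex.sub_re, Complex.sub_im, Complex.conj_re, Complex.conj_im]
  ring

theorem cayley_inv_mem {a u : ℂ} (ha : a ∈ upperHalf) (hu : ‖u‖ < 1) :
    (a - starRingEnd ℂ a * u) / (1 - u) ∈ upperHalf := by
  have ha' : 0 < a.im := ha
  have hu1 : (1 : ℂ) - u ≠ 0 := by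
    intro h
    rw [← sub_eq_zero.1 h] at hu
    simp at hu
  have hu2 : u.re * u.re + u.im * u.im < 1 := by
    have : ‖u‖ ^ 2 < 1 := by nlinarith [norm_nonneg u]
    rwa [← Complex.normSq_eq_norm_sq, Complex.normSq_apply] at this
  change 0 < ((a - starRingEnd ℂ a * u) / (1 - u)).im
  rw [Complex.div_im, ← sub_div]
  refine div_pos ?_ (Complex.normSq_pos.2 hu1)
  simp
  nlinarith [mul_pos ha' (sub_pos.2 hu2)]

/-- The Schwarz–Pick lemma in the upper half-plane. -/
theorem schwarz_pick_upperHalf {φ : ℂ → ℂ} (hd : DifferentiableOn ℂ φ upperHalf)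
    (hm : Set.MapsTo φ upperHalf upperHalf) {a z : ℂ} (ha : a ∈ upperHalf) (hz : z ∈ upperHalf) :
    ‖φ z - φ a‖ * ‖z - starRingEnd ℂ a‖ ≤ ‖z - a‖ * ‖φ z - starRingEnd ℂ (φ a)‖ := by
  have hpos : ∀ {v b : ℂ}, v ∈ upperHalf → b ∈ upperHalf → 0 < ‖v - starRingEnd ℂ b‖ :=
    fun hv hb => (norm_nonneg _).trans_lt (norm_sub_lt_norm_sub_conj hv hb)
  have hne : ∀ {v b : ℂ}, v ∈ upperHalf → b ∈ upperHalf → v - starRingEnd ℂ b ≠ 0 :=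
    fun hv hb => norm_pos_iff.1 (hpos hv hb)
  let κ : ℂ → ℂ := fun u => (a - starRingEnd ℂ a * u) / (1 - u)
  -- The map φ in disc coordinates centred at a and φ(a), to which the Schwarz lemma applies; `κ`
  -- inverts z ↦ (z - a)/(z - ā).
  let h : ℂ → ℂ := fun u => (φ (κ u) - φ a) / (φ (κ u) - starRingEnd ℂ (φ a))
  have hκm : Set.MapsTo κ (Metric.ball 0 1) upperHalf := fun u hu =>
    cayley_inv_mem ha (by simpa using hu)
  have hκd : DifferentiableOn ℂ κ (Metric.ball 0 1) := by
    refine DifferentiableOn.div (by fun_prop) (by fun_prop) fun u hu h => ?_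
    rw [← sub_eq_zero.1 h] at hu
    simp at hu
  have hφκ : DifferentiableOn ℂ (fun u => φ (κ u)) (Metric.ball 0 1) := hd.comp hκd hκm
  have hhd : DifferentiableOn ℂ h (Metric.ball 0 1) :=
    (hφκ.sub_const _).div (hφκ.sub_const _) fun u hu => hne (hm (hκm hu)) (hm ha)
  have hhm : Set.MapsTo h (Metric.ball 0 1) (Metric.closedBall 0 1) := by
    intro u hu
    rw [mem_closedBall_zero_iff, norm_div, div_le_one (hpos (hm (hκm hu)) (hm ha))]
    exact (norm_sub_lt_norm_sub_conj (hm (hκm hu)) (hm ha)).le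
  have hκ0 : κ 0 = a := by simp [κ]
  have hh0 : h 0 = 0 := by simp only [h, hκ0, sub_self, zero_div]
  have hu1 : ‖(z - a) / (z - starRingEnd ℂ a)‖ < 1 := by
    rw [norm_div, div_lt_one (hpos hz ha)]
    exact norm_sub_lt_norm_sub_conj hz ha
  have hκu : κ ((z - a) / (z - starRingEnd ℂ a)) = z := by
    have h1 := hne hz ha
    have h2 : a - starRingEnd ℂ a ≠ 0 := hne ha ha
    have h3 : 1 - (z - a) / (z - starRingEnd ℂ a) =
        (a - starRingEnd ℂ a) / (z - starRingEnd ℂ a) := by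
      field_simp; ring
    simp only [κ]
    rw [h3]
    field_simp
    ring
  have key := Complex.norm_le_norm_of_mapsTo_ball hhd hhm hh0 hu1
  simp only [h, hκu] at key
  rw [norm_div, norm_div, div_le_div_iff₀ (hpos (hm hz) (hm ha)) (hpos hz ha)] at key
  exact key

/-- Schwarz–Pick for φ and for its inverse gives equality; squaring and using |v - b̄|² = |v - b|² +
4 Im v Im b leaves the invariance of the hyperbolic distance. -/
theorem automorphism_upperHalf_identity {φ ψ : ℂ → ℂ} (hφ : DifferentiableOn ℂ φ upperHalf)
    (hψ : DifferentiableOn ℂ ψ upperHalf) (hφm : Set.MapsTo φ upperHalf upperHalf)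
    (hψm : Set.MapsTo ψ upperHalf upperHalf) (hinv : Set.LeftInvOn ψ φ upperHalf) {a z : ℂ}
    (ha : a ∈ upperHalf) (hz : z ∈ upperHalf) :
    ‖φ z - φ a‖ ^ 2 * (z.im * a.im) = ‖z - a‖ ^ 2 * ((φ z).im * (φ a).im) := by
  have h1 := schwarz_pick_upperHalf hφ hφm ha hz
  have h2 := schwarz_pick_upperHalf hψ hψm (hφm ha) (hφm hz)
  rw [hinv ha, hinv hz] at h2
  have h3 := le_antisymm h1 h2
  have h4 := congrArg (· ^ 2) h3
  simp only [mul_pow, norm_sub_conj_sq] at h4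
  linarith

theorem cobounded_inf_upperHalf_neBot : NeBot (Bornology.cobounded ℂ ⊓ 𝓟 upperHalf) := by
  have : Tendsto (fun t : ℝ => (t : ℂ) * Complex.I) atTop
      (Bornology.cobounded ℂ ⊓ 𝓟 upperHalf) := by
    refine tendsto_inf.2 ⟨?_, tendsto_principal.2 ?_⟩
    · rw [← tendsto_norm_atTop_iff_cobounded]
      simpa using tendsto_abs_atTop_atTop
    · filter_upwards [eventually_gt_atTop 0] with t ht
      simpa [upperHalf] using ht
  exact this.neBot

theorem tendsto_norm_sub_div_norm_sub (a b : ℂ) :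
    Tendsto (fun z => ‖z - a‖ / ‖z - b‖) (Bornology.cobounded ℂ) (𝓝 1) := by
  have h1 : Tendsto (fun z : ℂ => z - b) (Bornology.cobounded ℂ) (Bornology.cobounded ℂ) := by
    rw [← tendsto_norm_atTop_iff_cobounded]
    refine tendsto_atTop_mono (fun z => norm_sub_norm_le z b) ?_
    exact tendsto_atTop_add_const_right _ _ tendsto_norm_cobounded_atTop
  have h2 : Tendsto (fun z : ℂ => ‖1 + (b - a) * (z - b)⁻¹‖) (Bornology.cobounded ℂ) (𝓝 1) := by
    have h3 := ((tendsto_inv₀_cobounded.comp h1).const_mul (b - a)).const_add 1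
    simpa using h3.norm
  refine h2.congr' ?_
  have h4 : ∀ᶠ z : ℂ in Bornology.cobounded ℂ, z ≠ b := by
    filter_upwards [tendsto_norm_cobounded_atTop.eventually_gt_atTop ‖b‖] with z hz
    rintro rfl
    exact lt_irrefl _ hz
  filter_upwards [h4] with z hz
  have hz' : z - b ≠ 0 := sub_ne_zero.2 hz
  rw [← norm_div]
  congr 1
  field_simp
  ring

/-- An automorphism of the upper half-plane that fixes `∞` is affine. -/
theorem automorphism_upperHalf_affine {φ ψ : ℂ → ℂ} (hφ : DifferentiableOn ℂ φ upperHalf)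
    (hψ : DifferentiableOn ℂ ψ upperHalf) (hφm : Set.MapsTo φ upperHalf upperHalf)
    (hψm : Set.MapsTo ψ upperHalf upperHalf) (hinv : Set.LeftInvOn ψ φ upperHalf)
    (hinf : Tendsto φ (Bornology.cobounded ℂ ⊓ 𝓟 upperHalf) (Bornology.cobounded ℂ)) :
    ∃ p q : ℝ, 0 < p ∧ ∀ z ∈ upperHalf, φ z = p * z + q := by
  -- Divide the distance identities for a and b and let z → ∞: since φ(z) → ∞, the quotients of
  -- distances tend to 1. So Im φ is a multiple p of Im z, and φ - pz has imaginary part 0, hence is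
  -- constant.
  have hratio : ∀ a ∈ upperHalf, ∀ b ∈ upperHalf, (φ b).im * a.im = (φ a).im * b.im := by
    intro a ha b hb
    have := cobounded_inf_upperHalf_neBot
    have h1 := (((tendsto_norm_sub_div_norm_sub (φ a) (φ b)).comp hinf).pow 2).mul_const
      (a.im * (φ b).im)
    have h2 := (((tendsto_norm_sub_div_norm_sub a b).mono_left
      (inf_le_left (b := 𝓟 upperHalf))).pow 2).mul_const (b.im * (φ a).im)
    have h3 := tendsto_nhds_unique (h1.congr' ?_) h2
    · linarith
    have hne : ∀ᶠ z : ℂ in Bornology.cobounded ℂ ⊓ 𝓟 upperHalf, ‖b‖ < ‖z‖ :=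
      (tendsto_norm_cobounded_atTop.eventually_gt_atTop ‖b‖).filter_mono inf_le_left
    filter_upwards [hne, mem_inf_of_right (mem_principal_self upperHalf)] with z hzb hz
    have hzb' : z ≠ b := by rintro rfl; exact lt_irrefl _ hzb
    have hφ' : φ z ≠ φ b := fun h => hzb' (hinv.injOn hz hb h)
    have e1 := automorphism_upperHalf_identity hφ hψ hφm hψm hinv ha hz
    have e2 := automorphism_upperHalf_identity hφ hψ hφm hψm hinv hb hz
    have n1 : ‖z - b‖ ≠ 0 := norm_ne_zero_iff.2 (sub_ne_zero.2 hzb')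
    have n2 : ‖φ z - φ b‖ ≠ 0 := norm_ne_zero_iff.2 (sub_ne_zero.2 hφ')
    have i1 : z.im ≠ 0 := ne_of_gt hz
    have i2 : (φ z).im ≠ 0 := ne_of_gt (hφm hz)
    simp only [Function.comp]
    rw [div_pow, div_pow, div_mul_eq_mul_div, div_mul_eq_mul_div,
      div_eq_div_iff (pow_ne_zero 2 n2) (pow_ne_zero 2 n1)]
    refine mul_left_cancel₀ (mul_ne_zero i1 i2) ?_
    linear_combination ((φ z).im * (φ b).im * ‖z - b‖ ^ 2) * e1 -
      ((φ z).im * (φ a).im * ‖z - a‖ ^ 2) * e2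
  have hI : Complex.I ∈ upperHalf := by simp [upperHalf]
  set p := (φ Complex.I).im with hp
  have hp0 : 0 < p := hφm hI
  have him : ∀ z ∈ upperHalf, (φ z).im = p * z.im := by
    intro z hz
    have := hratio Complex.I hI z hz
    simpa using this
  have hg : DifferentiableOn ℂ (fun z => φ z - p * z) upperHalf := hφ.sub (by fun_prop)
  obtain ⟨c, hc⟩ := AnalyticOnNhd.eq_const_of_im_eq_const (c₀ := 0)
    (hg.analyticOnNhd isOpen_upperHalf) (fun z hz => by simp [him z hz]) isOpen_upperHalf
    ⟨⟨_, hI⟩, convex_upperHalf.isPreconnected⟩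
  have hcim : c.im = 0 := by
    rw [← hc _ hI]; simp [him _ hI]
  refine ⟨p, c.re, hp0, fun z hz => ?_⟩
  have h1 := hc z hz
  have h2 : (c.re : ℂ) = c := by apply Complex.ext <;> simp [hcim]
  rw [h2, ← h1]
  ring

/-! ### Uniqueness of the conformal mapping -/

/-- On a bounded set the real part is bounded above, because log t ≤ t for t ≥ 0. -/
theorem tendsto_of_tendsto_logMap_re_atTop {ι : Type*} {l : Filter ι} {f : ι → ℂ}
    (hα : 0 ≤ α) (hβ : 0 ≤ β)
    (hf : ∀ᶠ i in l, f i ∈ upperHalf)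
    (h : Tendsto (fun i => (logMap n α β ξ C (f i)).re) l atTop) :
    Tendsto f l (Bornology.cobounded ℂ) := by
  rw [← tendsto_norm_atTop_iff_cobounded, tendsto_atTop]
  intro R
  filter_upwards [hf, h.eventually_gt_atTop
    (C + ∑ j ∈ Finset.range (n + 2), endWeight n α β j * (R + |ξ j|))] with i hi hgt
  by_contra! hR
  refine absurd hgt (not_lt.2 ?_)
  rw [logMap_re]
  gcongr with j _
  · exact endWeight_nonneg hα hβ j
  · refine (Real.log_le_self (norm_nonneg _)).trans ((norm_sub_le _ _).trans ?_)
    rw [Complex.norm_real, Real.norm_eq_abs]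
    linarith

/-- A point at which the sum of logarithms tends to an infinite point is one of the `ξ_k`. -/
theorem eq_of_tendsto_leftEnd (E : Equioscillates n α β ξ C) {x a b : ℝ}
    (h : Tendsto (logMap n α β ξ C) (𝓝[upperHalf] (x : ℂ)) (leftEnd a b)) :
    ∃ k ≤ n + 1, endWeight n α β k ≠ 0 ∧ x = ξ k ∧
      (if k = n + 1 then -β / 2 else (n : ℝ) - k + endWeight n α β k / 2) ∈ Set.Icc a b := by
  obtain ⟨hre, him⟩ := tendsto_inf.1 h
  rw [tendsto_comap_iff] at hre
  by_cases hV : weightedProd n α β ξ x = 0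
  · obtain ⟨k, hk, hk0, rfl⟩ := exists_of_weightedProd_eq_zero hV
    refine ⟨k, hk, hk0, rfl, ?_⟩
    have h1 := (tendsto_vertical (ξ k)).eventually (tendsto_principal.1 him)
    refine isClosed_Icc.mem_of_tendsto (tendsto_logMap_im_vertical E hk) ?_
    filter_upwards [h1] with t ht using ⟨ht.1.le, ht.2.le⟩
  · have h1 := (Complex.continuous_re.tendsto _).comp (tendsto_logMap (C := C) hV)
    exact absurd h1 (not_tendsto_nhds_of_tendsto_atBot hre _)

theorem logMap_eq_of_tendsto {x : ℝ} {p : ℂ} (hα : 0 ≤ α) (hβ : 0 ≤ β)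
    (h : Tendsto (logMap n α β ξ C) (𝓝[upperHalf] (x : ℂ)) (𝓝 p)) :
    weightedProd n α β ξ x ≠ 0 ∧ logMap n α β ξ C x = p := by
  by_cases hV : weightedProd n α β ξ x = 0
  · obtain ⟨k, hk, hk0, rfl⟩ := exists_of_weightedProd_eq_zero hV
    have h1 := (Complex.continuous_re.tendsto _).comp h
    exact absurd h1
      (not_tendsto_nhds_of_tendsto_atBot (tendsto_logMap_re_atBot (C := C) hα hβ hk hk0) _)
  · exact ⟨hV, tendsto_nhds_unique (tendsto_logMap hV) h⟩

/-- For α > 0 the limiting heights at the other singular points lie below n. For α = 0 the height n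
forces x < ξ_1, where strict monotonicity of the product admits only one point with value e^{-C}. -/
theorem eq_zero_of_tendsto_endZero (E : Equioscillates n α β ξ C) (hα : 0 ≤ α) (hβ : 0 ≤ β)
    (hpos : 0 < α + β + n) {x : ℝ}
    (h : Tendsto (logMap n α β ξ C) (𝓝[upperHalf] (x : ℂ)) (endZero n α)) : x = 0 := by
  rw [endZero] at h
  split_ifs at h with h0
  · obtain ⟨hV, hx⟩ := logMap_eq_of_tendsto hα hβ h
    have hre : (logMap n α β ξ C x).re = 0 := by rw [hx]; simp
    have him : (logMap n α β ξ C x).im = n * Real.pi := by rw [hx]; simp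
    rw [logMap_re_eq_zero_iff hV] at hre
    have hx1 : x < ξ 1 := by
      by_contra! hx1
      rcases le_or_gt 1 x with h1 | h1
      · rw [logMap_im_of_one_le E h1] at him
        have h2 := mul_right_cancel₀ Real.pi_ne_zero him
        have h3 : (0 : ℝ) ≤ n := Nat.cast_nonneg n
        linarith
      · obtain ⟨k, hk, hk0, hk1⟩ := E.exists_gap ((E.mem_Icc (by omega)).1.trans hx1) h1
        rw [logMap_im_of_gap E hk hk0 hk1] at him
        have h2 := mul_right_cancel₀ Real.pi_ne_zero him
        have h3 : k = 0 := by
          have : (k : ℝ) = 0 := by linarith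
          exact_mod_cast this
        subst h3
        exact absurd hk1 (not_lt.2 hx1)
    have hV0 := weightedProd_zero E h0 hβ hpos
    have h01 : 0 < ξ 1 := by have := E.lt 0 (Nat.zero_le n); rwa [E.zero] at this
    rcases lt_trichotomy x 0 with h1 | h1 | h1
    · have := weightedProd_lt_of_lt_left E h0 hβ hpos h1 h01.le
      linarith
    · exact h1
    · have := weightedProd_lt_of_lt_left E h0 hβ hpos h1 hx1.le
      linarith
  · obtain ⟨k, hk, hk0, rfl, h1, h2⟩ := eq_of_tendsto_leftEnd E h
    rcases Nat.eq_zero_or_pos k with h3 | h3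
    · rw [h3, E.zero]
    · exfalso
      split_ifs at h1 with h4
      · subst h4
        rw [endWeight_last] at hk0
        have := lt_of_le_of_ne hβ hk0.symm
        have h3 : (0 : ℝ) ≤ n := Nat.cast_nonneg n
        linarith
      · rw [endWeight_of_mem _ _ h3 (by omega)] at h1
        have : (1 : ℝ) ≤ k := by exact_mod_cast h3
        linarith

theorem eq_one_of_tendsto_endOne (E : Equioscillates n α β ξ C) (hα : 0 ≤ α) (hβ : 0 ≤ β)
    (hpos : 0 < α + β + n) {x : ℝ}
    (h : Tendsto (logMap n α β ξ C) (𝓝[upperHalf] (x : ℂ)) (endOne β)) : x = 1 := by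
  rw [endOne] at h
  split_ifs at h with h0
  · obtain ⟨hV, hx⟩ := logMap_eq_of_tendsto hα hβ h
    have hre : (logMap n α β ξ C x).re = 0 := by rw [hx]; simp
    have him : (logMap n α β ξ C x).im = 0 := by rw [hx]; simp
    rw [logMap_re_eq_zero_iff hV] at hre
    have hxn : ξ n ≤ x := by
      by_contra! hxn
      rcases lt_or_ge x 0 with h1 | h1
      · rw [logMap_im_of_neg E h1] at him
        have h2 := (mul_eq_zero.1 him).resolve_right Real.pi_ne_zero
        linarith
      · obtain ⟨k, hk, hk0, hk1⟩ := E.exists_gap h1 (hxn.trans_le (E.mem_Icc (by omega)).2)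
        rw [logMap_im_of_gap E hk hk0 hk1] at him
        have h2 := (mul_eq_zero.1 him).resolve_right Real.pi_ne_zero
        have h3 : k = n := by
          have : (k : ℝ) = n := by linarith
          exact_mod_cast this
        subst h3
        exact absurd hk0 (not_le.2 hxn)
    have hV0 := weightedProd_one E hα h0 hpos
    have h01 : ξ n < 1 := by have := E.lt n le_rfl; rwa [E.last] at this
    rcases lt_trichotomy x 1 with h1 | h1 | h1
    · have := weightedProd_lt_of_lt_right E hα h0 hpos h1 hxn
      linarith
    · exact h1
    · have := weightedProd_lt_of_lt_right E hα h0 hpos h1 h01.le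
      linarith
  · obtain ⟨k, hk, hk0, rfl, h1, h2⟩ := eq_of_tendsto_leftEnd E h
    split_ifs at h2 with h4
    · rw [h4, E.last]
    · exfalso
      have h5 : (k : ℝ) ≤ n := by exact_mod_cast (by omega : k ≤ n)
      have h6 := lt_of_le_of_ne (endWeight_nonneg hα hβ k) hk0.symm
      linarith

theorem eq_of_tendsto_end (E : Equioscillates n α β ξ C) (hα : 0 ≤ α) (hβ : 0 ≤ β) {x : ℝ}
    {j : ℕ} (hj : 1 ≤ j) (hj' : j ≤ n)
    (h : Tendsto (logMap n α β ξ C) (𝓝[upperHalf] (x : ℂ))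
      (leftEnd ((n : ℝ) - j) ((n : ℝ) - j + 1))) : x = ξ j := by
  obtain ⟨k, hk, hk0, rfl, h1, h2⟩ := eq_of_tendsto_leftEnd E h
  have hw := lt_of_le_of_ne (endWeight_nonneg hα hβ k) hk0.symm
  have hj1 : (1 : ℝ) ≤ j := by exact_mod_cast hj
  have hjn : (j : ℝ) ≤ n := by exact_mod_cast hj'
  by_cases h4 : k = n + 1
  · rw [if_pos h4] at h1
    rw [h4, endWeight_last] at hw
    linarith
  rw [if_neg h4] at h1 h2
  rcases Nat.eq_zero_or_pos k with h3 | h3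
  · rw [h3] at h2 hw
    rw [Nat.cast_zero] at h2
    linarith
  · rw [endWeight_of_mem _ _ h3 (by omega)] at h1 h2
    have h5 : (k : ℝ) < j + 1 := by linarith
    have h6 : (j : ℝ) < k + 1 := by linarith
    have h7 : k < j + 1 := by exact_mod_cast h5
    have h8 : j < k + 1 := by exact_mod_cast h6
    rw [show k = j by omega]

/-- With f the sum of logarithms, f⁻¹ ∘ w is an automorphism of the half-plane fixing ∞, so w(z) =
f(pz + q). The boundary conditions at 0 and 1 then give q = 0 and p + q = 1. -/
theorem IsCombMap.eqOn_logMap (E : Equioscillates n α β ξ C) (hα : 0 ≤ α) (hβ : 0 ≤ β)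
    (hpos : 0 < α + β + n) {w : ℂ → ℂ} (hw : IsCombMap n α β w) :
    Set.EqOn w (logMap n α β ξ C) upperHalf := by
  set f := logMap n α β ξ C with hf
  have hfc : IsCombMap n α β f := isCombMap_logMap E hα hβ hpos
  set g := Function.invFunOn f upperHalf with hg
  set g' := Function.invFunOn w upperHalf with hg'
  have hgm : Set.MapsTo g (combDomain n α β) upperHalf := hfc.bijOn.surjOn.mapsTo_invFunOn
  have hgm' : Set.MapsTo g' (combDomain n α β) upperHalf := hw.bijOn.surjOn.mapsTo_invFunOn
  have hgd : DifferentiableOn ℂ g (combDomain n α β) := by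
    rw [← hfc.bijOn.image_eq]
    exact differentiableOn_of_leftInvOn isOpen_upperHalf hfc.differentiableOn
      hfc.bijOn.injOn.leftInvOn_invFunOn
  have hgd' : DifferentiableOn ℂ g' (combDomain n α β) := by
    rw [← hw.bijOn.image_eq]
    exact differentiableOn_of_leftInvOn isOpen_upperHalf hw.differentiableOn
      hw.bijOn.injOn.leftInvOn_invFunOn
  have hfg : ∀ p ∈ combDomain n α β, f (g p) = p := hfc.bijOn.surjOn.rightInvOn_invFunOn
  have hφm : Set.MapsTo (g ∘ w) upperHalf upperHalf := hgm.comp hw.bijOn.mapsTo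
  have hfφ : ∀ z ∈ upperHalf, f ((g ∘ w) z) = w z := fun z hz => hfg _ (hw.bijOn.mapsTo hz)
  obtain ⟨p, q, hp, hpq⟩ := automorphism_upperHalf_affine (φ := g ∘ w) (ψ := g' ∘ f)
    (hgd.comp hw.differentiableOn hw.bijOn.mapsTo)
    (hgd'.comp hfc.differentiableOn hfc.bijOn.mapsTo) hφm (hgm'.comp hfc.bijOn.mapsTo)
    (fun z hz => by
      change g' (f ((g ∘ w) z)) = z
      rw [hfφ z hz]
      exact hw.bijOn.injOn.leftInvOn_invFunOn hz)
    (by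
      refine tendsto_of_tendsto_logMap_re_atTop (n := n) (ξ := ξ) (C := C) hα hβ ?_ ?_
      · filter_upwards [mem_inf_of_right (mem_principal_self upperHalf)] with z hz using hφm hz
      · refine hw.map_infty.congr' ?_
        filter_upwards [mem_inf_of_right (mem_principal_self upperHalf)] with z hz
        rw [← hf, hfφ z hz])
  have hp0 : (p : ℂ) ≠ 0 := Complex.ofReal_ne_zero.2 hp.ne'
  have hwf : ∀ z ∈ upperHalf, w z = f (p * z + q) := fun z hz => by
    rw [← hfφ z hz, hpq z hz]
  -- transport of boundary values by the affine map
  have htrans : ∀ (x : ℝ) (l : Filter ℂ), Tendsto w (𝓝[upperHalf] (x : ℂ)) l →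
      Tendsto f (𝓝[upperHalf] ((p * x + q : ℝ) : ℂ)) l := by
    intro x l h
    have h1 : Tendsto (fun ζ : ℂ => (ζ - q) / p) (𝓝[upperHalf] ((p * x + q : ℝ) : ℂ))
        (𝓝[upperHalf] (x : ℂ)) := by
      refine tendsto_nhdsWithin_iff.2 ⟨?_, ?_⟩
      · have hc : Continuous (fun ζ : ℂ => (ζ - q) / p) := by fun_prop
        have h2 := hc.tendsto ((p * x + q : ℝ) : ℂ)
        have h3 : (((p * x + q : ℝ) : ℂ) - q) / p = x := by
          push_cast; field_simp; ring
        rw [h3] at h2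
        exact h2.mono_left nhdsWithin_le_nhds
      · filter_upwards [self_mem_nhdsWithin] with ζ hζ
        change 0 < ((ζ - q) / p).im
        rw [Complex.div_ofReal_im]
        refine div_pos ?_ hp
        simpa using! hζ
    refine (h.comp h1).congr' ?_
    filter_upwards [h1.eventually self_mem_nhdsWithin] with ζ hζ
    simp only [Function.comp]
    rw [hwf _ hζ]
    congr 1
    field_simp; ring
  have h0 := eq_zero_of_tendsto_endZero E hα hβ hpos
    (htrans 0 _ (by simpa using hw.map_zero))
  have h1 := eq_one_of_tendsto_endOne E hα hβ hpos
    (htrans 1 _ (by simpa using hw.map_one))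
  have hq : q = 0 := by linarith
  have hp1 : p = 1 := by linarith
  intro z hz
  rw [hwf z hz, hq, hp1]
  simp

theorem IsCombMap.endPreimages_eq (E : Equioscillates n α β ξ C) (hα : 0 ≤ α) (hβ : 0 ≤ β)
    (hpos : 0 < α + β + n) {w : ℂ → ℂ} (hw : IsCombMap n α β w) {ζ : ℕ → ℝ}
    (hζ : IsEndPreimages n w ζ) {j : ℕ} (hj : 1 ≤ j) (hj' : j ≤ n) : ζ j = ξ j := by
  refine eq_of_tendsto_end E hα hβ hj hj' ((hζ j hj hj').congr' ?_)
  filter_upwards [self_mem_nhdsWithin] with z hz using hw.eqOn_logMap E hα hβ hpos hz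

theorem IsCombMap.combConstant_eq (E : Equioscillates n α β ξ C) (hα : 0 ≤ α) (hβ : 0 ≤ β)
    (hpos : 0 < α + β + n) {w : ℂ → ℂ} (hw : IsCombMap n α β w) {D : ℝ}
    (hD : IsCombConstant n α β w D) : D = C := by
  have := cobounded_inf_upperHalf_neBot
  have hinv : Tendsto (fun z : ℂ => z⁻¹) (Bornology.cobounded ℂ ⊓ 𝓟 upperHalf) (𝓝 0) :=
    tendsto_inv₀_cobounded.mono_left inf_le_left
  have h1 := hD.trans_tendsto hinv
  have h2 := (isCombConstant_logMap (n := n) (α := α) (β := β) (ξ := ξ) (C := C)).trans_tendsto hinv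
  have h3 := h2.sub h1
  have h4 : Tendsto (fun _ : ℂ => (D : ℂ) - C) (Bornology.cobounded ℂ ⊓ 𝓟 upperHalf)
      (𝓝 (0 - 0)) := by
    refine h3.congr' ?_
    filter_upwards [mem_inf_of_right (mem_principal_self upperHalf)] with z hz
    rw [hw.eqOn_logMap E hα hβ hpos hz]
    ring
  have h5 := tendsto_nhds_unique tendsto_const_nhds h4
  rw [sub_zero, sub_eq_zero] at h5
  exact_mod_cast h5

/-! ### The upper bound -/

/-- The factors of the equioscillating product up to the index `m` and after it, taken at two
different points `s ≤ r`, still have a product at most `e^{-C}`. -/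
theorem Equioscillates.split_le (E : Equioscillates n α β ξ C) (hα : 0 ≤ α) (hβ : 0 ≤ β) {m : ℕ}
    (hm : m ≤ n) {s r : ℝ} (hs : 0 ≤ s) (hsr : s ≤ r) (hr : r ≤ 1) :
    (|s| ^ α * ∏ j ∈ Finset.Ioc 0 m, |s - ξ j|) *
      (|1 - r| ^ β * ∏ j ∈ Finset.Ioc m n, |r - ξ j|) ≤ Real.exp (-C) := by
  set A : ℝ → ℝ := fun s => |s| ^ α * ∏ j ∈ Finset.Ioc 0 m, |s - ξ j| with hA
  set B : ℝ → ℝ := fun r => |1 - r| ^ β * ∏ j ∈ Finset.Ioc m n, |r - ξ j| with hB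
  have hA0 : ∀ x, 0 ≤ A x := fun x => by positivity
  have hB0 : ∀ x, 0 ≤ B x := fun x => by positivity
  have hAB : ∀ x, weightedProd n α β ξ x = A x * B x := by
    intro x
    rw [weightedProd_eq E.zero E.last, ← Finset.prod_Ioc_consecutive _ (Nat.zero_le m) hm]
    simp only [hA, hB]; ring
  have hAmono : ∀ x y, ξ m ≤ x → x ≤ y → A x ≤ A y := by
    intro x y hx hxy
    have hx0 : 0 ≤ x := (E.mem_Icc (by omega : m ≤ n + 1)).1.trans hx
    simp only [hA]
    gcongr with j hj
    have hj' := Finset.mem_Ioc.1 hj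
    linarith [E.le_of_le hj'.2 (by omega)]
  have hBanti : ∀ x y, x ≤ y → y ≤ ξ (m + 1) → B y ≤ B x := by
    intro x y hxy hy
    have hy1 : y ≤ 1 := hy.trans (E.mem_Icc (by omega : m + 1 ≤ n + 1)).2
    have h1 : |1 - y| ≤ |1 - x| := by
      rw [abs_of_nonneg (by linarith), abs_of_nonneg (by linarith)]; linarith
    refine mul_le_mul (Real.rpow_le_rpow (abs_nonneg _) h1 hβ) (Finset.prod_le_prod
      (fun _ _ => abs_nonneg _) fun j hj => ?_) (by positivity) (by positivity)
    have hj' := Finset.mem_Ioc.1 hj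
    have := E.le_of_le (show m + 1 ≤ j from hj'.1) (by omega)
    rw [abs_of_nonpos (by linarith), abs_of_nonpos (by linarith)]
    linarith
  have hle : ∀ x, 0 ≤ x → x ≤ 1 → A x * B x ≤ Real.exp (-C) := fun x h0 h1 => by
    rw [← hAB]; exact E.le_exp x ⟨h0, h1⟩
  obtain ⟨x, hx, hxe⟩ := E.exists_eq m hm
  rw [hAB] at hxe
  have hpos : 0 < A x * B x := by rw [hxe]; exact Real.exp_pos _
  have hBx : 0 < B x := pos_of_mul_pos_right hpos (hA0 x)
  have hAx : 0 < A x := pos_of_mul_pos_left hpos (hB0 x)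
  change A s * B r ≤ Real.exp (-C)
  -- If x, a maximum point in [ξ_m, ξ_{m+1}], is not strictly between s and r, both points can be
  -- moved to s or both to r. Otherwise A(s)B(x) ≤ A(s)B(s) ≤ A(x)B(x) gives A(s) ≤ A(x), and
  -- likewise B(r) ≤ B(x).
  rcases le_total r x with h1 | h1
  · exact (mul_le_mul_of_nonneg_left (hBanti s r hsr (h1.trans hx.2)) (hA0 s)).trans
      (hle s hs (hsr.trans hr))
  rcases le_total x s with h2 | h2
  · exact (mul_le_mul_of_nonneg_right (hAmono s r (hx.1.trans h2) hsr) (hB0 r)).trans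
      (hle r (hs.trans hsr) hr)
  have h3 : A s ≤ A x := by
    refine le_of_mul_le_mul_right ?_ hBx
    rw [hxe]
    exact (mul_le_mul_of_nonneg_left (hBanti s x h2 hx.2) (hA0 s)).trans
      (hle s hs (hsr.trans hr))
  have h4 : B r ≤ B x := by
    refine le_of_mul_le_mul_left ?_ hAx
    rw [hxe]
    exact (mul_le_mul_of_nonneg_right (hAmono x r hx.1 h1) (hB0 r)).trans
      (hle r (hs.trans hsr) hr)
  rw [← hxe]
  exact mul_le_mul h3 h4 (hB0 r) hAx.le

theorem abs_sq_rpow_half {r : ℝ} (hr : 0 ≤ r) (m : ℕ) : |r ^ 2| ^ ((m : ℝ) / 2) = r ^ m := by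
  rw [abs_of_nonneg (sq_nonneg r), ← Real.rpow_natCast r 2, ← Real.rpow_mul hr,
    ← Real.rpow_natCast r m]
  congr 1
  push_cast
  ring

/-! ### Means over the torus -/

/-- The mean of `z₁^{-m₁} z₂^{-m₂} f` over the products of two regular `M`-gons of radii `ρ`, `σ`
(up to the factor `ρ^{m₁} σ^{m₂}`). -/
def torusMean (M m₁ m₂ : ℕ) (ω : ℂ) (ρ σ : ℝ) (f : ℂ × ℂ → ℂ) : ℂ :=
  ((M : ℂ) ^ 2)⁻¹ * ∑ p ∈ Finset.range M, ∑ q ∈ Finset.range M,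
    (ω ^ p) ^ (-(m₁ : ℤ)) * (ω ^ q) ^ (-(m₂ : ℤ)) * f (ρ * ω ^ p, σ * ω ^ q)

/-- Orthogonality of characters; the bound on e excludes aliasing, so finite sums replace integrals
over the circle. -/
theorem sum_pow_zpow {M : ℕ} {ω : ℂ} (hω : IsPrimitiveRoot ω M) {e : ℤ} (he : |e| < M) :
    ∑ p ∈ Finset.range M, (ω ^ p) ^ e = if e = 0 then (M : ℂ) else 0 := by
  split_ifs with h
  · simp [h]
  · have h1 : ω ^ e ≠ 1 := by
      rw [Ne, hω.zpow_eq_one_iff_dvd]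
      intro hd
      exact h (Int.eq_zero_of_abs_lt_dvd hd he)
    have h2 : ∀ p : ℕ, (ω ^ p) ^ e = (ω ^ e) ^ p := fun p => by
      rw [← zpow_natCast, ← zpow_natCast, ← zpow_mul, ← zpow_mul, mul_comm]
    simp only [h2]
    have h3 := geom_sum_mul (ω ^ e) M
    have h4 : (ω ^ e) ^ M = 1 := by
      rw [← h2, hω.pow_eq_one, one_zpow]
    rw [h4, sub_self] at h3
    exact (mul_eq_zero.1 h3).resolve_right (sub_ne_zero.2 h1)

theorem torusMean_stdMonomial {M m₁ m₂ a b c d : ℕ} {ω : ℂ} (hω : IsPrimitiveRoot ω M)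
    (hM : M ≠ 0) (h1 : a + b + m₁ < M) (h2 : c + d + m₂ < M) (ρ σ : ℝ) :
    torusMean M m₁ m₂ ω ρ σ (stdMonomial a b c d) =
      if a = b + m₁ ∧ c = d + m₂ then (ρ : ℂ) ^ (a + b) * (σ : ℂ) ^ (c + d) else 0 := by
  have hn : ‖ω‖ = 1 := hω.norm'_eq_one hM
  have hω0 : ω ≠ 0 := hω.ne_zero hM
  have hconj : ∀ p : ℕ, starRingEnd ℂ (ω ^ p) = (ω ^ p)⁻¹ := by
    intro p
    rw [Complex.inv_eq_conj]
    rw [norm_pow, hn, one_pow]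
  have hfac : ∀ (p : ℕ) (r : ℝ) (x y m : ℕ), (ω ^ p) ^ (-(m : ℤ)) *
      ((r * ω ^ p) ^ x * (starRingEnd ℂ (r * ω ^ p)) ^ y) =
      (r : ℂ) ^ (x + y) * (ω ^ p) ^ ((x : ℤ) - y - m) := by
    intro p r x y m
    have h0 : ω ^ p ≠ 0 := pow_ne_zero _ hω0
    rw [map_mul, Complex.conj_ofReal, hconj, mul_pow, mul_pow, zpow_sub₀ h0, zpow_sub₀ h0, zpow_neg,
      zpow_natCast, zpow_natCast, zpow_natCast, inv_pow, pow_add]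
    field_simp
  have hsum : ∀ p q : ℕ, (ω ^ p) ^ (-(m₁ : ℤ)) * (ω ^ q) ^ (-(m₂ : ℤ)) *
      stdMonomial a b c d (ρ * ω ^ p, σ * ω ^ q) =
      ((ρ : ℂ) ^ (a + b) * (ω ^ p) ^ ((a : ℤ) - b - m₁)) *
        ((σ : ℂ) ^ (c + d) * (ω ^ q) ^ ((c : ℤ) - d - m₂)) := by
    intro p q
    rw [← hfac, ← hfac, stdMonomial]
    ring
  rw [torusMean]
  simp only [hsum]
  rw [← Finset.sum_mul_sum, ← Finset.mul_sum, ← Finset.mul_sum,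
    sum_pow_zpow hω (by rw [abs_lt]; constructor <;> omega),
    sum_pow_zpow hω (by rw [abs_lt]; constructor <;> omega)]
  have hM' : (M : ℂ) ≠ 0 := Nat.cast_ne_zero.2 hM
  by_cases h3 : a = b + m₁
  · by_cases h4 : c = d + m₂
    · rw [if_pos (by omega), if_pos (by omega), if_pos ⟨h3, h4⟩]
      field_simp
    · rw [if_neg (by omega : ¬ ((c : ℤ) - d - m₂ = 0)),
        if_neg (fun h : a = b + m₁ ∧ c = d + m₂ => h4 h.2)]
      simp
  · rw [if_neg (by omega : ¬ ((a : ℤ) - b - m₁ = 0)),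
      if_neg (fun h : a = b + m₁ ∧ c = d + m₂ => h3 h.1)]
    simp

theorem norm_torusMean_le {M m₁ m₂ : ℕ} {ω : ℂ} (hω : ‖ω‖ = 1) {ρ σ D : ℝ} (hM : M ≠ 0)
    {f : ℂ × ℂ → ℂ} (hρ : ρ ^ 2 + σ ^ 2 ≤ 1) (hf : ∀ z ∈ unitBall, ‖f z‖ ≤ D) :
    ‖torusMean M m₁ m₂ ω ρ σ f‖ ≤ D := by
  have h1 : ∀ p q : ℕ, ‖(ω ^ p) ^ (-(m₁ : ℤ)) * (ω ^ q) ^ (-(m₂ : ℤ)) *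
      f (ρ * ω ^ p, σ * ω ^ q)‖ ≤ D := by
    intro p q
    rw [norm_mul, norm_mul, norm_zpow, norm_zpow, norm_pow, norm_pow, hω]
    simp only [one_pow, one_zpow, one_mul]
    refine hf _ ?_
    change ‖(ρ : ℂ) * ω ^ p‖ ^ 2 + ‖(σ : ℂ) * ω ^ q‖ ^ 2 ≤ 1
    rw [norm_mul, norm_mul, norm_pow, norm_pow, hω, Complex.norm_real, Complex.norm_real]
    simpa using hρ
  have h2 : ‖∑ p ∈ Finset.range M, ∑ q ∈ Finset.range M,
      (ω ^ p) ^ (-(m₁ : ℤ)) * (ω ^ q) ^ (-(m₂ : ℤ)) * f (ρ * ω ^ p, σ * ω ^ q)‖ ≤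
      (M : ℝ) ^ 2 * D := by
    refine (norm_sum_le_of_le _ fun p _ => norm_sum_le_of_le _ fun q _ => h1 p q).trans_eq ?_
    simp; ring
  rw [torusMean, norm_mul, norm_inv, norm_pow, Complex.norm_natCast]
  have hM' : (0 : ℝ) < (M : ℝ) ^ 2 := by positivity
  rw [inv_mul_le_iff₀ hM']
  exact h2

theorem torusMean_sub (M m₁ m₂ : ℕ) (ω : ℂ) (ρ σ : ℝ) (f g : ℂ × ℂ → ℂ) :
    torusMean M m₁ m₂ ω ρ σ (fun z => f z - g z) =
      torusMean M m₁ m₂ ω ρ σ f - torusMean M m₁ m₂ ω ρ σ g := by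
  simp only [torusMean, mul_sub, Finset.sum_sub_distrib]

theorem torusMean_sum {ι : Type*} (s : Finset ι) (M m₁ m₂ : ℕ) (ω : ℂ) (ρ σ : ℝ) (c : ι → ℂ)
    (f : ι → ℂ × ℂ → ℂ) :
    torusMean M m₁ m₂ ω ρ σ (fun z => ∑ i ∈ s, c i * f i z) =
      ∑ i ∈ s, c i * torusMean M m₁ m₂ ω ρ σ (f i) := by
  simp only [torusMean, Finset.mul_sum]
  refine (Finset.sum_congr rfl fun p _ => ?_).trans Finset.sum_comm
  refine (Finset.sum_congr rfl fun q _ => ?_).trans Finset.sum_comm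
  exact Finset.sum_congr rfl fun i _ => by ring

theorem evalPoly_eq_sum (P : MvPolynomial (Fin 4) ℂ) (z : ℂ × ℂ) :
    evalPoly P z = ∑ s ∈ P.support, P.coeff s * stdMonomial (s 0) (s 1) (s 2) (s 3) z := by
  rw [evalPoly, MvPolynomial.eval_eq']
  refine Finset.sum_congr rfl fun s _ => ?_
  rw [Fin.prod_univ_four, stdMonomial]
  congr 1
  simp [mul_assoc]

/-! ### The lower bound -/

/-- The divided difference of order n, which reads off the coefficient of t^n in the Lagrange
interpolation formula. -/
theorem sum_lagrange_weight {x : ℕ → ℝ} (hx : Set.InjOn x (Finset.range (n + 1))) {P : Polynomial ℝ}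
    (hP : P.natDegree ≤ n) :
    ∑ i ∈ Finset.range (n + 1), P.eval (x i) / ∏ j ∈ (Finset.range (n + 1)).erase i, (x i - x j) =
      P.coeff n := by
  rw [← Lagrange.coeff_eq_sum hx, Finset.card_range, Nat.add_sub_cancel]
  rw [Finset.card_range]
  exact (Polynomial.degree_le_of_natDegree_le hP).trans_lt (by exact_mod_cast Nat.lt_succ_self n)

theorem sum_lagrange_weight_pow {x : ℕ → ℝ} (hx : Set.InjOn x (Finset.range (n + 1))) {b d : ℕ}
    (hbd : b + d ≤ n) :
    ∑ i ∈ Finset.range (n + 1), x i ^ b * (1 - x i) ^ d /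
      ∏ j ∈ (Finset.range (n + 1)).erase i, (x i - x j) = if b + d = n then (-1) ^ d else 0 := by
  set Q : Polynomial ℝ := Polynomial.X ^ b * (Polynomial.X - Polynomial.C 1) ^ d with hQ
  have hm : Q.Monic := (Polynomial.monic_X_pow b).mul ((Polynomial.monic_X_sub_C 1).pow d)
  have hdeg : Q.natDegree = b + d := by
    rw [hQ, (Polynomial.monic_X_pow b).natDegree_mul ((Polynomial.monic_X_sub_C 1).pow d),
      Polynomial.natDegree_X_pow, (Polynomial.monic_X_sub_C 1).natDegree_pow,
      Polynomial.natDegree_X_sub_C, mul_one]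
  have h1 := sum_lagrange_weight hx (P := Polynomial.C ((-1) ^ d) * Q)
    ((Polynomial.natDegree_C_mul_le _ _).trans (by omega))
  have h2 : ∀ t : ℝ, (Polynomial.C ((-1 : ℝ) ^ d) * Q).eval t = t ^ b * (1 - t) ^ d := by
    intro t
    have : (1 - t) ^ d = (-1) ^ d * (t - 1) ^ d := by rw [← mul_pow]; congr 1; ring
    rw [this, hQ]
    simp
    ring
  simp only [h2] at h1
  rw [h1, Polynomial.coeff_C_mul]
  split_ifs with h
  · rw [← h, ← hdeg, Polynomial.Monic.coeff_natDegree hm, mul_one]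
  · rw [Polynomial.coeff_eq_zero_of_natDegree_lt (by omega), mul_zero]

/-- The maximum points of the equioscillating product. -/
theorem Equioscillates.exists_points (E : Equioscillates n α β ξ C) :
    ∃ x : ℕ → ℝ, (∀ i ≤ n, x i ∈ Set.Icc (0 : ℝ) 1) ∧
      (∀ i ≤ n, weightedProd n α β ξ (x i) = Real.exp (-C)) ∧
      Set.InjOn x (Finset.range (n + 1)) ∧
      ∀ i ≤ n, 0 < (∏ j ∈ Finset.Ioc 0 n, (x i - ξ j)) /
        ∏ j ∈ (Finset.range (n + 1)).erase i, (x i - x j) := by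
  choose! x hx hxe using E.exists_eq
  have hne : ∀ i ≤ n, ∀ j, 1 ≤ j → j ≤ n → x i ≠ ξ j := by
    intro i hi j h1 h2 h
    have h3 := hxe i hi
    rw [h, weightedProd_eq_zero_of_eq (by omega) (by
      rw [endWeight_of_mem _ _ h1 h2]; norm_num)] at h3
    exact (Real.exp_pos _).ne h3
  have hlow : ∀ i ≤ n, ∀ j, 1 ≤ j → j ≤ i → ξ j < x i := fun i hi j h1 h2 =>
    lt_of_le_of_ne ((E.le_of_le h2 (by omega)).trans (hx i hi).1) (hne i hi j h1 (by omega)).symm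
  have hupp : ∀ i ≤ n, ∀ j, i < j → j ≤ n → x i < ξ j := fun i hi j h1 h2 =>
    lt_of_le_of_ne ((hx i hi).2.trans (E.le_of_le h1 (by omega))) (hne i hi j (by omega) h2)
  have hlt : ∀ i j, i < j → j ≤ n → x i < x j := fun i j hij hj =>
    (hupp i (by omega) j hij hj).trans (hlow j hj j (by omega) le_rfl)
  refine ⟨x, fun i hi => ?_, hxe, ?_, fun i hi => ?_⟩
  · exact ⟨(E.mem_Icc (by omega)).1.trans (hx i hi).1,
      (hx i hi).2.trans (E.mem_Icc (by omega)).2⟩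
  · intro i hi j hj hij
    have hi' : i < n + 1 := by simpa using hi
    have hj' : j < n + 1 := by simpa using hj
    rcases lt_trichotomy i j with h | h | h
    · exact absurd hij (hlt i j h (by omega)).ne
    · exact h
    · exact absurd hij (hlt j i h (by omega)).ne'
  -- The nodes and the ξ_j interlace: factors with j ≤ i are positive in numerator and denominator,
  -- those with j > i are negative in both and are paired.
  · have hsplit : (Finset.range (n + 1)).erase i = Finset.range i ∪ Finset.Ioc i n := by
      ext j; simp only [Finset.mem_erase, Finset.mem_range, Finset.mem_union, Finset.mem_Ioc]; omega
    have hdisj : Disjoint (Finset.range i) (Finset.Ioc i n) := by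
      rw [Finset.disjoint_left]; intro j; simp only [Finset.mem_range, Finset.mem_Ioc]; omega
    rw [hsplit, Finset.prod_union hdisj, ← Finset.prod_Ioc_consecutive _ (Nat.zero_le i) hi,
      mul_div_mul_comm, ← Finset.prod_div_distrib]
    refine mul_pos (div_pos (Finset.prod_pos fun j hj => ?_) (Finset.prod_pos fun j hj => ?_))
      (Finset.prod_pos fun j hj => ?_)
    · have := Finset.mem_Ioc.1 hj
      exact sub_pos.2 (hlow i hi j (by omega) this.2)
    · exact sub_pos.2 (hlt j i (Finset.mem_range.1 hj) hi)
    · have := Finset.mem_Ioc.1 hj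
      exact div_pos_of_neg_of_neg (sub_neg.2 (hupp i hi j this.1 this.2))
        (sub_neg.2 (hlt i j this.1 this.2))

/-- The annihilating functional. On the torus over x_i, a monomial that survives the mean equals v_i
x_i^b (1 - x_i)^q with v_i = x_i^α (1 - x_i)^β; its total degree is m₁ + m₂ + 2(b + q), so lower
degree means b + q < n and the divided difference vanishes. -/
theorem Equioscillates.exp_le_of_isMonicPoly {k₁ l₁ k₂ l₂ : ℕ} (h₁ : l₁ ≤ k₁) (h₂ : l₂ ≤ k₂)
    (hα : α = ((k₁ : ℝ) - l₁) / 2) (hβ : β = ((k₂ : ℝ) - l₂) / 2)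
    (E : Equioscillates (l₁ + l₂) α β ξ C) {f : ℂ × ℂ → ℂ} (hf : IsMonicPoly k₁ l₁ k₂ l₂ f)
    {D : ℝ} (hD : ∀ z ∈ unitBall, ‖f z‖ ≤ D) : Real.exp (-C) ≤ D := by
  obtain ⟨P, hP, hfP⟩ := hf
  obtain ⟨m₁, rfl⟩ : ∃ m, k₁ = l₁ + m := ⟨k₁ - l₁, by omega⟩
  obtain ⟨m₂, rfl⟩ : ∃ m, k₂ = l₂ + m := ⟨k₂ - l₂, by omega⟩
  have hα' : α = (m₁ : ℝ) / 2 := by rw [hα]; push_cast; ring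
  have hβ' : β = (m₂ : ℝ) / 2 := by rw [hβ]; push_cast; ring
  obtain ⟨x, hx01, hxe, hinj, hsign⟩ := E.exists_points
  set n := l₁ + l₂ with hn
  set N := l₁ + m₁ + l₁ + (l₂ + m₂) + l₂ with hN
  -- Larger than every frequency that occurs, since degrees and m₁, m₂ are at most N.
  set M := 2 * N + 1 with hMdef
  have hM : M ≠ 0 := by omega
  obtain ⟨ω, hω⟩ : ∃ ω : ℂ, IsPrimitiveRoot ω M := ⟨_, Complex.isPrimitiveRoot_exp M hM⟩
  set ρ : ℕ → ℝ := fun i => √(x i) with hρ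
  set σ : ℕ → ℝ := fun i => √(1 - x i) with hσ
  have hρ2 : ∀ i ≤ n, ρ i ^ 2 = x i := fun i hi => Real.sq_sqrt (hx01 i hi).1
  have hσ2 : ∀ i ≤ n, σ i ^ 2 = 1 - x i := fun i hi =>
    Real.sq_sqrt (by linarith [(hx01 i hi).2])
  have hVi : ∀ i ≤ n, weightedProd n α β ξ (x i) =
      ρ i ^ m₁ * σ i ^ m₂ * |∏ j ∈ Finset.Ioc 0 n, (x i - ξ j)| := by
    intro i hi
    rw [weightedProd_eq E.zero E.last, Finset.abs_prod, hα', hβ',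
      ← abs_sq_rpow_half (Real.sqrt_nonneg (x i)) m₁,
      ← abs_sq_rpow_half (Real.sqrt_nonneg (1 - x i)) m₂]
    rw [show √(x i) ^ 2 = x i from hρ2 i hi, show √(1 - x i) ^ 2 = 1 - x i from hσ2 i hi]
  set v : ℕ → ℝ := fun i => ρ i ^ m₁ * σ i ^ m₂ with hv
  have hv0 : ∀ i ≤ n, 0 < v i := by
    intro i hi
    have h1 := hxe i hi
    rw [hVi i hi] at h1
    have h2 : 0 < v i * |∏ j ∈ Finset.Ioc 0 n, (x i - ξ j)| := by
      rw [hv]; simp only; rw [h1]; exact Real.exp_pos _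
    exact pos_of_mul_pos_left h2 (abs_nonneg _)
  set c : ℕ → ℝ := fun i => (∏ j ∈ (Finset.range (n + 1)).erase i, (x i - x j))⁻¹ with hc
  -- the total mass of the functional
  have hmass : ∑ i ∈ Finset.range (n + 1), |c i| / v i = Real.exp C := by
    have h1 : ∑ i ∈ Finset.range (n + 1), (∏ j ∈ Finset.Ioc 0 n, (x i - ξ j)) * c i = 1 := by
      set J : Polynomial ℝ := ∏ j ∈ Finset.Ioc 0 n, (Polynomial.X - Polynomial.C (ξ j)) with hJ
      have hJm : J.Monic := Polynomial.monic_prod_X_sub_C _ _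
      have hJd : J.natDegree = n := by
        rw [hJ, Polynomial.natDegree_finsetProd_X_sub_C_eq_card]; simp
      have h2 := sum_lagrange_weight hinj hJd.le
      have h3 : J.coeff n = 1 := by
        conv_lhs => rw [← hJd]
        exact hJm
      rw [h3] at h2
      rw [← h2]
      refine Finset.sum_congr rfl fun i _ => ?_
      rw [hJ, Polynomial.eval_prod]
      simp [hc, div_eq_mul_inv]
    rw [← mul_one (Real.exp C), ← h1, Finset.mul_sum]
    refine Finset.sum_congr rfl fun i hi => ?_
    have hi' : i ≤ n := by have := Finset.mem_range.1 hi; omega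
    have h2 : 0 < (∏ j ∈ Finset.Ioc 0 n, (x i - ξ j)) * c i := by
      rw [hc]; simp only; rw [← div_eq_mul_inv]; exact hsign i hi'
    have h3 := hxe i hi'
    rw [hVi i hi'] at h3
    rw [← abs_of_pos h2, abs_mul, div_eq_iff (hv0 i hi').ne']
    have h4 : Real.exp C * Real.exp (-C) = 1 := by
      rw [← Real.exp_add, add_neg_cancel, Real.exp_zero]
    rw [← h3] at h4
    simp only [hv]
    linear_combination (-|c i|) * h4
  -- the functional on monomials
  have hmono : ∀ a b p q : ℕ, a + b + p + q ≤ N →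
      ∑ i ∈ Finset.range (n + 1), ((c i / v i : ℝ) : ℂ) *
        torusMean M m₁ m₂ ω (ρ i) (σ i) (stdMonomial a b p q) =
      if a = b + m₁ ∧ p = q + m₂ ∧ b + q = n then (-1) ^ q else 0 := by
    intro a b p q habpq
    by_cases h : a = b + m₁ ∧ p = q + m₂
    · have hbq : b + q ≤ n := by omega
      have h1 := sum_lagrange_weight_pow hinj hbq
      have h2 : ∀ i ∈ Finset.range (n + 1), ((c i / v i : ℝ) : ℂ) *
          torusMean M m₁ m₂ ω (ρ i) (σ i) (stdMonomial a b p q) =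
          ((x i ^ b * (1 - x i) ^ q /
            ∏ j ∈ (Finset.range (n + 1)).erase i, (x i - x j) : ℝ) : ℂ) := by
        intro i hi
        have hi' : i ≤ n := by have := Finset.mem_range.1 hi; omega
        rw [torusMean_stdMonomial hω hM (by omega) (by omega), if_pos h]
        rw [← Complex.ofReal_pow, ← Complex.ofReal_pow, ← Complex.ofReal_mul, ← Complex.ofReal_mul]
        congr 1
        have h3 : ρ i ^ (a + b) * σ i ^ (p + q) = v i * (x i ^ b * (1 - x i) ^ q) := by
          rw [← hσ2 i hi', ← hρ2 i hi', h.1, h.2, hv]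
          ring
        rw [h3, div_mul_eq_mul_div, div_eq_iff (hv0 i hi').ne', div_eq_mul_inv]
        simp only [hc]
        ring
      rw [Finset.sum_congr rfl h2, ← Complex.ofReal_sum, h1]
      by_cases h4 : b + q = n
      · rw [if_pos h4, if_pos ⟨h.1, h.2, h4⟩]; push_cast; ring
      · rw [if_neg h4, if_neg (fun h5 => h4 h5.2.2)]; simp
    · rw [if_neg (fun h5 => h ⟨h5.1, h5.2.1⟩)]
      refine Finset.sum_eq_zero fun i _ => ?_
      rw [torusMean_stdMonomial hω hM (by omega) (by omega), if_neg h, mul_zero]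
  have hΛ : ∑ i ∈ Finset.range (n + 1), ((c i / v i : ℝ) : ℂ) *
      torusMean M m₁ m₂ ω (ρ i) (σ i) f = (-1) ^ l₂ := by
    have hf' : f = fun z => stdMonomial (l₁ + m₁) l₁ (l₂ + m₂) l₂ z -
        ∑ s ∈ P.support, P.coeff s * stdMonomial (s 0) (s 1) (s 2) (s 3) z := by
      funext z; rw [hfP, evalPoly_eq_sum]
    rw [hf']
    simp only [torusMean_sub, torusMean_sum, mul_sub, Finset.sum_sub_distrib]
    rw [hmono _ _ _ _ (by omega), if_pos ⟨rfl, rfl, rfl⟩]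
    simp only [Finset.mul_sum]
    rw [Finset.sum_comm, Finset.sum_eq_zero, sub_zero]
    intro s hs
    have hdeg : s 0 + s 1 + s 2 + s 3 < N := by
      have h1 := MvPolynomial.le_totalDegree hs
      rw [Finsupp.sum_fintype _ _ (by simp), Fin.sum_univ_four] at h1
      omega
    have h1 := hmono (s 0) (s 1) (s 2) (s 3) hdeg.le
    rw [if_neg (by omega)] at h1
    rw [← mul_zero (P.coeff s), ← h1, Finset.mul_sum]
    exact Finset.sum_congr rfl fun i _ => by ring
  have hnorm : (1 : ℝ) ≤ Real.exp C * D := by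
    calc (1 : ℝ) = ‖((-1) ^ l₂ : ℂ)‖ := by simp
      _ ≤ ∑ i ∈ Finset.range (n + 1), |c i| / v i * D := by
        rw [← hΛ]
        refine norm_sum_le_of_le _ fun i hi => ?_
        have hi' : i ≤ n := by have := Finset.mem_range.1 hi; omega
        rw [norm_mul, Complex.norm_real, Real.norm_eq_abs, abs_div, abs_of_pos (hv0 i hi')]
        refine mul_le_mul_of_nonneg_left (norm_torusMean_le (hω.norm'_eq_one hM) hM ?_ hD)
          (div_nonneg (abs_nonneg _) (hv0 i hi').le)
        rw [hρ2 i hi', hσ2 i hi']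
        linarith
      _ = Real.exp C * D := by rw [← Finset.sum_mul, hmass]
  rw [Real.exp_neg, inv_le_iff_one_le_mul₀ (Real.exp_pos C), mul_comm]
  exact hnorm

/-! ### The extremal polynomial -/

/-- `F = G + R` with `G` of total degree at most `d` and `R` of total degree less than `d`. -/
def HasLeadingPart (F G : MvPolynomial (Fin 4) ℂ) (d : ℕ) : Prop :=
  G.totalDegree ≤ d ∧ (F - G = 0 ∨ (F - G).totalDegree < d)

/-- The alternative of a zero remainder is needed for factors of degree 0, because the zero
polynomial has `totalDegree` 0, which is not less than 0. -/
theorem HasLeadingPart.mul {F G F' G' : MvPolynomial (Fin 4) ℂ} {d d' : ℕ}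
    (h : HasLeadingPart F G d) (h' : HasLeadingPart F' G' d') :
    HasLeadingPart (F * F') (G * G') (d + d') := by
  have hadd : ∀ {R R' : MvPolynomial (Fin 4) ℂ} {e : ℕ}, (R = 0 ∨ R.totalDegree < e) →
      (R' = 0 ∨ R'.totalDegree < e) → (R + R' = 0 ∨ (R + R').totalDegree < e) := by
    rintro R R' e (rfl | h1) h2
    · simpa using h2
    rcases h2 with rfl | h2
    · right; simpa using h1
    · right; exact (MvPolynomial.totalDegree_add _ _).trans_lt (max_lt h1 h2)
  have hmul : ∀ {R S : MvPolynomial (Fin 4) ℂ} {e e' : ℕ}, (R = 0 ∨ R.totalDegree < e) →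
      S.totalDegree ≤ e' → (R * S = 0 ∨ (R * S).totalDegree < e + e') := by
    rintro R S e e' (rfl | h1) h2
    · left; simp
    · right; exact (MvPolynomial.totalDegree_mul _ _).trans_lt (by omega)
  refine ⟨(MvPolynomial.totalDegree_mul _ _).trans (add_le_add h.1 h'.1), ?_⟩
  have e : F * F' - G * G' = (F' - G') * G + ((F - G) * G' + (F - G) * (F' - G')) := by ring
  rw [e]
  refine hadd (by rw [add_comm d]; exact hmul h'.2 h.1) (hadd (hmul h.2 h'.1) ?_)
  rcases h'.2 with h1 | h1
  · left; rw [h1, mul_zero]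
  · exact hmul h.2 h1.le

theorem hasLeadingPart_self {F : MvPolynomial (Fin 4) ℂ} {d : ℕ} (h : F.totalDegree ≤ d) :
    HasLeadingPart F F d := ⟨h, Or.inl (sub_self F)⟩

theorem hasLeadingPart_X_pow (i : Fin 4) (m : ℕ) :
    HasLeadingPart (MvPolynomial.X i ^ m) (MvPolynomial.X i ^ m) m :=
  hasLeadingPart_self (MvPolynomial.totalDegree_X_pow i m).le

theorem hasLeadingPart_prod (i j : Fin 4) (s : Finset ℕ) (c : ℕ → ℂ) :
    HasLeadingPart (∏ k ∈ s, (MvPolynomial.X i * MvPolynomial.X j - MvPolynomial.C (c k)))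
      ((MvPolynomial.X i * MvPolynomial.X j) ^ s.card) (2 * s.card) := by
  have h1 : ∀ k, HasLeadingPart (MvPolynomial.X i * MvPolynomial.X j - MvPolynomial.C (c k))
      (MvPolynomial.X i * MvPolynomial.X j) 2 := by
    intro k
    refine ⟨(MvPolynomial.totalDegree_mul _ _).trans ?_, Or.inr ?_⟩
    · simp [MvPolynomial.totalDegree_X]
    · rw [sub_sub_cancel_left, MvPolynomial.totalDegree_neg, MvPolynomial.totalDegree_C]
      norm_num
  induction s using Finset.induction_on with
  | empty => simpa using! hasLeadingPart_self (F := 1) (d := 0) (by simp)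
  | insert a s ha ih =>
    rw [Finset.prod_insert ha, Finset.card_insert_of_notMem ha, pow_succ',
      show 2 * (s.card + 1) = 2 + 2 * s.card by ring]
    exact (h1 a).mul ih

/-- The polynomial `z₁^{m₁} z₂^{m₂} ∏_{j ≤ l₁} (|z₁|² - ξ_j) ∏_{j > l₁} (|z₂|² - (1 - ξ_j))`. -/
def extremalPoly (m₁ l₁ m₂ l₂ : ℕ) (ξ : ℕ → ℝ) (z : ℂ × ℂ) : ℂ :=
  z.1 ^ m₁ * z.2 ^ m₂ * (∏ j ∈ Finset.Ioc 0 l₁, ((‖z.1‖ ^ 2 - ξ j : ℝ) : ℂ)) *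
    ∏ j ∈ Finset.Ioc l₁ (l₁ + l₂), ((‖z.2‖ ^ 2 - (1 - ξ j) : ℝ) : ℂ)

theorem isMonicPoly_extremalPoly (m₁ l₁ m₂ l₂ : ℕ) (ξ : ℕ → ℝ)
    (hpos : 0 < l₁ + m₁ + l₁ + (l₂ + m₂) + l₂) :
    IsMonicPoly (l₁ + m₁) l₁ (l₂ + m₂) l₂ (extremalPoly m₁ l₁ m₂ l₂ ξ) := by
  set F : MvPolynomial (Fin 4) ℂ := MvPolynomial.X 0 ^ m₁ * MvPolynomial.X 2 ^ m₂ *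
    (∏ j ∈ Finset.Ioc 0 l₁, (MvPolynomial.X 0 * MvPolynomial.X 1 - MvPolynomial.C (ξ j : ℂ))) *
    ∏ j ∈ Finset.Ioc l₁ (l₁ + l₂),
      (MvPolynomial.X 2 * MvPolynomial.X 3 - MvPolynomial.C (1 - ξ j : ℂ)) with hF
  set G : MvPolynomial (Fin 4) ℂ := MvPolynomial.X 0 ^ m₁ * MvPolynomial.X 2 ^ m₂ *
    (MvPolynomial.X 0 * MvPolynomial.X 1) ^ l₁ * (MvPolynomial.X 2 * MvPolynomial.X 3) ^ l₂ with hG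
  have h := (((hasLeadingPart_X_pow 0 m₁).mul (hasLeadingPart_X_pow 2 m₂)).mul
    (hasLeadingPart_prod 0 1 (Finset.Ioc 0 l₁) fun j => (ξ j : ℂ))).mul
    (hasLeadingPart_prod 2 3 (Finset.Ioc l₁ (l₁ + l₂)) fun j => 1 - (ξ j : ℂ))
  rw [Nat.card_Ioc, Nat.card_Ioc, Nat.sub_zero, Nat.add_sub_cancel_left] at h
  refine ⟨G - F, ?_, fun z => ?_⟩
  · rw [← neg_sub, MvPolynomial.totalDegree_neg]
    rcases h.2 with h0 | h0
    · change F - G = 0 at h0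
      rw [h0, MvPolynomial.totalDegree_zero]; exact hpos
    · refine h0.trans_le ?_
      omega
  · have hconj : ∀ a : ℂ, a * starRingEnd ℂ a = ((‖a‖ ^ 2 : ℝ) : ℂ) := fun a => by
      rw [Complex.mul_conj, Complex.normSq_eq_norm_sq]
    have h1 : evalPoly F z = extremalPoly m₁ l₁ m₂ l₂ ξ z := by
      simp only [evalPoly, hF, extremalPoly, map_mul, map_pow, map_prod, map_sub,
        MvPolynomial.eval_X, MvPolynomial.eval_C]
      simp [← hconj]
    have h2 : evalPoly G z = stdMonomial (l₁ + m₁) l₁ (l₂ + m₂) l₂ z := by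
      simp only [evalPoly, hG, stdMonomial, map_mul, map_pow, MvPolynomial.eval_X]
      simp
      ring
    have h3 : evalPoly (G - F) z = evalPoly G z - evalPoly F z := by
      simp only [evalPoly, map_sub]
    rw [h3, h1, h2]
    ring

theorem IsMonicPoly.continuous {k₁ l₁ k₂ l₂ : ℕ} {f : ℂ × ℂ → ℂ}
    (hf : IsMonicPoly k₁ l₁ k₂ l₂ f) : Continuous f := by
  have hmon : ∀ a b c d : ℕ, Continuous (stdMonomial a b c d) := by
    intro a b c d
    have hc : Continuous (starRingEnd ℂ) := Complex.continuous_conj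
    unfold stdMonomial
    fun_prop
  obtain ⟨P, -, h⟩ := hf
  have h' : f = fun z => stdMonomial k₁ l₁ k₂ l₂ z -
      ∑ s ∈ P.support, P.coeff s * stdMonomial (s 0) (s 1) (s 2) (s 3) z := by
    funext z; rw [h, evalPoly_eq_sum]
  rw [h']
  exact (hmon _ _ _ _).sub (continuous_finsetSum _ fun s _ => continuous_const.mul (hmon _ _ _ _))

theorem isCompact_unitBall : IsCompact unitBall := by
  refine Metric.isCompact_of_isClosed_isBounded
    (isClosed_le (by fun_prop) continuous_const) ?_
  refine (Metric.isBounded_closedBall (x := (0 : ℂ × ℂ)) (r := 1)).subset fun z hz => ?_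
  have hz' : ‖z.1‖ ^ 2 + ‖z.2‖ ^ 2 ≤ 1 := hz
  rw [mem_closedBall_zero_iff, Prod.norm_def]
  refine max_le ?_ ?_ <;> nlinarith [norm_nonneg z.1, norm_nonneg z.2, sq_nonneg ‖z.1‖,
    sq_nonneg ‖z.2‖]

theorem IsMonicPoly.norm_le_ballNorm {k₁ l₁ k₂ l₂ : ℕ} {f : ℂ × ℂ → ℂ}
    (hf : IsMonicPoly k₁ l₁ k₂ l₂ f) {z : ℂ × ℂ} (hz : z ∈ unitBall) : ‖f z‖ ≤ ballNorm f :=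
  le_csSup (isCompact_unitBall.image hf.continuous.norm).bddAbove ⟨z, hz, rfl⟩

theorem norm_extremalPoly (m₁ l₁ m₂ l₂ : ℕ) (ξ : ℕ → ℝ) (z : ℂ × ℂ) :
    ‖extremalPoly m₁ l₁ m₂ l₂ ξ z‖ =
      (|‖z.1‖ ^ 2| ^ ((m₁ : ℝ) / 2) * ∏ j ∈ Finset.Ioc 0 l₁, |‖z.1‖ ^ 2 - ξ j|) *
      (|1 - (1 - ‖z.2‖ ^ 2)| ^ ((m₂ : ℝ) / 2) *
        ∏ j ∈ Finset.Ioc l₁ (l₁ + l₂), |1 - ‖z.2‖ ^ 2 - ξ j|) := by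
  have h : ∀ j, |1 - ‖z.2‖ ^ 2 - ξ j| = |‖z.2‖ ^ 2 - (1 - ξ j)| := fun j => by
    rw [← abs_neg]; congr 1; ring
  rw [sub_sub_cancel, abs_sq_rpow_half (norm_nonneg _), abs_sq_rpow_half (norm_nonneg _)]
  simp only [h]
  simp only [extremalPoly, norm_mul, norm_pow, norm_prod, Complex.norm_real, Real.norm_eq_abs]
  ring

/-- On the sphere, at (√x, √(1 - x)), the modulus is the weighted product at x, so e^{-C} is
attained; inside the ball |z₁|² ≤ 1 - |z₂|² and `Equioscillates.split_le` applies. -/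
theorem Equioscillates.ballNorm_extremalPoly {m₁ l₁ m₂ l₂ : ℕ}
    (E : Equioscillates (l₁ + l₂) ((m₁ : ℝ) / 2) ((m₂ : ℝ) / 2) ξ C) :
    ballNorm (extremalPoly m₁ l₁ m₂ l₂ ξ) = Real.exp (-C) := by
  refine IsGreatest.csSup_eq ⟨?_, ?_⟩
  · obtain ⟨x, hx, hxe⟩ := E.exists_eq 0 (Nat.zero_le _)
    have hx0 : 0 ≤ x := E.zero ▸ hx.1
    have hx1 : x ≤ 1 := hx.2.trans (E.mem_Icc (by omega)).2
    have e1 : ‖((√x : ℝ) : ℂ)‖ ^ 2 = x := by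
      rw [Complex.norm_real, Real.norm_eq_abs, sq_abs, Real.sq_sqrt hx0]
    have e2 : ‖((√(1 - x) : ℝ) : ℂ)‖ ^ 2 = 1 - x := by
      rw [Complex.norm_real, Real.norm_eq_abs, sq_abs, Real.sq_sqrt (by linarith)]
    refine ⟨(((√x : ℝ) : ℂ), ((√(1 - x) : ℝ) : ℂ)), ?_, ?_⟩
    · change ‖((√x : ℝ) : ℂ)‖ ^ 2 + ‖((√(1 - x) : ℝ) : ℂ)‖ ^ 2 ≤ 1
      rw [e1, e2]; linarith
    · simp only
      rw [norm_extremalPoly, ← hxe, weightedProd_eq E.zero E.last,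
        ← Finset.prod_Ioc_consecutive _ (Nat.zero_le l₁) (Nat.le_add_right l₁ l₂)]
      simp only [e1, e2, sub_sub_cancel]
      ring
  · rintro _ ⟨z, hz, rfl⟩
    have hz' : ‖z.1‖ ^ 2 + ‖z.2‖ ^ 2 ≤ 1 := hz
    simp only
    rw [norm_extremalPoly]
    exact E.split_le (by positivity) (by positivity) (Nat.le_add_right l₁ l₂) (sq_nonneg _)
      (by linarith) (by linarith [sq_nonneg ‖z.2‖])

theorem Equioscillates.isLeastDeviation_extremalPoly {m₁ l₁ m₂ l₂ : ℕ}
    (hpos : 0 < l₁ + m₁ + l₁ + (l₂ + m₂) + l₂)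
    (E : Equioscillates (l₁ + l₂) ((m₁ : ℝ) / 2) ((m₂ : ℝ) / 2) ξ C) :
    IsLeastDeviation (l₁ + m₁) l₁ (l₂ + m₂) l₂ (extremalPoly m₁ l₁ m₂ l₂ ξ) := by
  have hm := isMonicPoly_extremalPoly m₁ l₁ m₂ l₂ ξ hpos
  have hmem : ballNorm (extremalPoly m₁ l₁ m₂ l₂ ξ) ∈
      ballNorm '' {f | IsMonicPoly (l₁ + m₁) l₁ (l₂ + m₂) l₂ f} := Set.mem_image_of_mem _ hm
  refine ⟨hm, ((show IsLeast _ _ from ⟨hmem, ?_⟩).csInf_eq).symm⟩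
  rintro _ ⟨f, hf, rfl⟩
  rw [E.ballNorm_extremalPoly]
  exact E.exp_le_of_isMonicPoly (Nat.le_add_right _ _) (Nat.le_add_right _ _)
    (by push_cast; ring) (by push_cast; ring) hf fun z hz => hf.norm_le_ballNorm hz

/-! ### The extremal polynomial in terms of the uniform Jacobi polynomial -/

theorem jacobiProd_eval (ξ : ℕ → ℝ) (a b : ℕ) (t : ℝ) :
    (jacobiProd ξ a b).eval t = ∏ j ∈ Finset.Ioc a b, (t - ξ j) := by
  simp [jacobiProd, Polynomial.eval_prod]

theorem exp_mul_extremalPoly (m₁ l₁ m₂ l₂ : ℕ) (ξ : ℕ → ℝ) (C : ℝ) (z : ℂ × ℂ) :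
    (Real.exp C : ℂ) * z.1 ^ m₁ * z.2 ^ m₂ *
      (((jacobiProd ξ 0 l₁).eval (‖z.1‖ ^ 2) : ℝ) : ℂ) *
      ((-1 : ℂ) ^ l₂ * (((jacobiProd ξ l₁ (l₁ + l₂)).eval (1 - ‖z.2‖ ^ 2) : ℝ) : ℂ)) =
    (Real.exp C : ℂ) * extremalPoly m₁ l₁ m₂ l₂ ξ z := by
  have h : (-1 : ℂ) ^ l₂ * (((jacobiProd ξ l₁ (l₁ + l₂)).eval (1 - ‖z.2‖ ^ 2) : ℝ) : ℂ) =
      ∏ j ∈ Finset.Ioc l₁ (l₁ + l₂), ((‖z.2‖ ^ 2 - (1 - ξ j) : ℝ) : ℂ) := by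
    have hc : (-1 : ℂ) ^ l₂ = ∏ _j ∈ Finset.Ioc l₁ (l₁ + l₂), (-1 : ℂ) := by simp
    rw [jacobiProd_eval, hc, Complex.ofReal_prod, ← Finset.prod_mul_distrib]
    refine Finset.prod_congr rfl fun j _ => ?_
    push_cast
    ring
  rw [h, jacobiProd_eval, Complex.ofReal_prod, extremalPoly]
  ring

theorem jacobiProd_congr {ξ ζ : ℕ → ℝ} {a b : ℕ} (h : ∀ j, a < j → j ≤ b → ζ j = ξ j) :
    jacobiProd ζ a b = jacobiProd ξ a b :=
  Finset.prod_congr rfl fun j hj => by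
    rw [h j (Finset.mem_Ioc.1 hj).1 (Finset.mem_Ioc.1 hj).2]

end

theorem theorem3 (k₁ l₁ k₂ l₂ : ℕ) (h₁ : l₁ ≤ k₁) (h₂ : l₂ ≤ k₂)
    (hpos : 0 < k₁ + l₁ + k₂ + l₂) (α β : ℝ)
    (hα : α = ((k₁ : ℝ) - l₁) / 2) (hβ : β = ((k₂ : ℝ) - l₂) / 2) :
    (∃ (w : ℂ → ℂ) (ξ : ℕ → ℝ) (C : ℝ), IsCombMap (l₁ + l₂) α β w ∧
      IsEndPreimages (l₁ + l₂) w ξ ∧ IsCombConstant (l₁ + l₂) α β w C) ∧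
    ∀ (w : ℂ → ℂ) (ξ : ℕ → ℝ) (C : ℝ), IsCombMap (l₁ + l₂) α β w →
      IsEndPreimages (l₁ + l₂) w ξ → IsCombConstant (l₁ + l₂) α β w C →
      IsNormalizedLeastDeviation k₁ l₁ k₂ l₂ (fun z =>
        (Real.exp C : ℂ) * z.1 ^ (k₁ - l₁) * z.2 ^ (k₂ - l₂) *
          (((jacobiProd ξ 0 l₁).eval (‖z.1‖ ^ 2) : ℝ) : ℂ) *
          ((-1 : ℂ) ^ l₂ * (((jacobiProd ξ l₁ (l₁ + l₂)).eval (1 - ‖z.2‖ ^ 2) : ℝ) : ℂ))) := by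
  obtain ⟨m₁, rfl⟩ := Nat.exists_eq_add_of_le h₁
  obtain ⟨m₂, rfl⟩ := Nat.exists_eq_add_of_le h₂
  obtain rfl : α = (m₁ : ℝ) / 2 := by rw [hα]; push_cast; ring
  obtain rfl : β = (m₂ : ℝ) / 2 := by rw [hβ]; push_cast; ring
  have hα0 : (0 : ℝ) ≤ (m₁ : ℝ) / 2 := by positivity
  have hβ0 : (0 : ℝ) ≤ (m₂ : ℝ) / 2 := by positivity
  have hsum : (0 : ℝ) < (m₁ : ℝ) / 2 + (m₂ : ℝ) / 2 + ((l₁ + l₂ : ℕ) : ℝ) := by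
    have h3 : 0 < m₁ + m₂ + 2 * (l₁ + l₂) := by omega
    have h4 : (0 : ℝ) < ((m₁ + m₂ + 2 * (l₁ + l₂) : ℕ) : ℝ) := by exact_mod_cast h3
    push_cast at h4 ⊢
    linarith
  -- The equioscillating data prove existence, and uniqueness identifies the points and the constant
  -- of an arbitrary comb mapping with them.
  obtain ⟨ζ, D, E⟩ := exists_equioscillates (l₁ + l₂) hα0 hβ0
  refine ⟨⟨logMap _ _ _ ζ D, ζ, D, isCombMap_logMap E hα0 hβ0 hsum,
    isEndPreimages_logMap E hα0 hβ0 hsum, isCombConstant_logMap⟩, ?_⟩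
  intro w ξ C hw hξ hC
  obtain rfl : C = D := hw.combConstant_eq E hα0 hβ0 hsum hC
  have hξζ : ∀ j, 1 ≤ j → j ≤ l₁ + l₂ → ξ j = ζ j := fun j h3 h4 =>
    hw.endPreimages_eq E hα0 hβ0 hsum hξ h3 h4
  refine ⟨_, E.isLeastDeviation_extremalPoly hpos, ?_, fun z => ?_⟩
  · rw [E.ballNorm_extremalPoly]; exact Real.exp_pos _
  · beta_reduce
    rw [E.ballNorm_extremalPoly, jacobiProd_congr (a := 0) (b := l₁) (fun j h3 h4 =>
      hξζ j h3 (by omega)), jacobiProd_congr (a := l₁) (b := l₁ + l₂) (fun j h3 h4 =>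
      hξζ j (by omega) h4), Nat.add_sub_cancel_left, Nat.add_sub_cancel_left,
      exp_mul_extremalPoly, Real.exp_neg, Complex.ofReal_inv, div_inv_eq_mul, mul_comm]
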